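/- **Setting.** Let $m,n:\mathbb R\to\mathbb R$ satisfy the following. (A1) $m$ is smooth and, for some $m_0<0$, for every $a\in\mathbb N_0$ there is $C_a$ with $|m^{(a)}(k)|\le C_a(1+|k|)^{m_0-a}$ for all $k\in\mathbb R$. (A2) $m$ is even, $m(0)>0$, $m(k)<m(0)$ for $k\neq 0$, and for some integer $j_\star\ge 1$ one has $m^{(2j_\star)}(0)<0$ and $m(k)=m(0)+\frac{m^{(2j_\star)}(0)}{(2j_\star)!}k^{2j_\star}+O(k^{2j_\star+2})$ as $k\to0$. (A3) $n\in C^2(\mathbb R)$ and $n=n_p+n_{\mathrm r}$, where for some real $p\in[2,4j_\star+1)$ either $n_p(x)=c_p|x|^p$ with $c_p\ne0$, or $p$ is an odd integer and $n_p(x)=c_px^p$ with $c_p>0$; and for some $\delta>0$, $n_{\mathrm r}(x)=O(|x|^{p+\delta})$ and $n_{\mathrm r}'(x)=O(|x|^{p+\delta-1})$ as $x\to0$. For $P>0$ let $L^2_P$ be the space of real-valued $P$-periodic, locally square-integrable functions $u(x)=P^{-1/2}\sum_{k\in\mathbb Z}\hat u_k e^{2\pi i kx/P}$, and let $H^1_P$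 be the space of those $u\in L^2_P$ with $$\|u\|_{H^1_P}^2=\sum_{k\in\mathbb Z}\Big(1+\frac{4\pi^2k^2}{P^2}\Big)|\hat u_k|^2<\infty .$$ Let $L$ be the Fourier multiplier with symbol $m$, so that $(\widehat{Lu})_k=m(2\pi k/P)\,\hat u_k$, let $N(x)=\int_0^x n(s)\,ds$, and put $$\mathcal Q_P(u)=\frac12\int_{-P/2}^{P/2}u^2\,dx,\qquad \mathcal E_P(u)=-\frac12\int_{-P/2}^{P/2}u\,Lu\,dx-\int_{-P/2}^{P/2}N(u)\,dx .$$ Fix $R>0$ and, for $\mu>0$, let $U_{P,\mu}=\{u\in H^1_P:\ \|u\|_{H^1_P}<R,\ \mathcal Q_P(u)=\mu\}$. A prime denotes the $L^2_P$-derivative: $\mathcal F'(u)\in L^2_P$ represents the Fréchet derivative at $u$ of a functional $\mathcal F$ on $H^1_P$, in the sense that $\mathrm d\mathcal F[u](v)=\int_{-P/2}^{P/2}\mathcal F'(u)\,v\,dx$ for all $v\in H^1_P$. **Theorem (existence of periodic minimisers).** There exist constants $c>0$ and $\mu_\star>0$ such that for each $\mu\in(0,\mu_\star)$ there is $P_\mu>0$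 with the following property. For each $P\ge P_\mu$ there exists a (continuous) function $\bar u_P\in U_{P,\mu}$ which minimises $\mathcal E_P$ over $U_{P,\mu}$, so that $$\mathcal E_P(\bar u_P)=\inf\{\mathcal E_P(u):u\in U_{P,\mu}\},$$ and which satisfies the Euler–Lagrange equation $$\mathcal E_P'(\bar u_P)+\nu_P\,\mathcal Q_P'(\bar u_P)=0$$ for some real number $\nu_P$; it is a $P$-periodic solution, with wave speed $\nu_P$, of the travelling-wave equation $$L\bar u_P-\nu_P\bar u_P+n(\bar u_P)=0 .$$ Furthermore $$\|\bar u_P\|_{H^1_P}^2\le c\mu,\qquad 0<\nu_P\le c,$$ where $c$ is independent of both $\mu\in(0,\mu_\star)$ and $P\ge P_\mu$. -/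

import Mathlib

open Set Filter Topology MeasureTheory Asymptotics
open scoped ContDiff Nat

noncomputable section

namespace Whitham

/-! ### Assumptions on the symbol `m` and the nonlinearity `n` -/

/-- (A1): `m` is a smooth classical symbol of order `m₀ < 0`. -/
structure AssumptionA1 (m : ℝ → ℝ) (m₀ : ℝ) : Prop where
  order_neg : m₀ < 0
  smooth : ContDiff ℝ ∞ m
  bound : ∀ a : ℕ, ∃ C : ℝ, ∀ k : ℝ,
    |iteratedDeriv a m k| ≤ C * (1 + |k|) ^ (m₀ - (a : ℝ))

/-- (A2): `m` is even with a strict positive global maximum at `0`, and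
`m(k) = m(0) + m^{(2j)}(0) k^{2j} / (2j)! + O(k^{2j+2})` as `k → 0`, with `j ≥ 1` and
`m^{(2j)}(0) < 0`. -/
structure AssumptionA2 (m : ℝ → ℝ) (j : ℕ) : Prop where
  j_pos : 1 ≤ j
  even : ∀ k : ℝ, m (-k) = m k
  zero_pos : 0 < m 0
  lt_zero : ∀ k : ℝ, k ≠ 0 → m k < m 0
  deriv_neg : iteratedDeriv (2 * j) m 0 < 0
  expansion :
    (fun k : ℝ => m k - (m 0 + iteratedDeriv (2 * j) m 0 / ((2 * j)! : ℝ) * k ^ (2 * j)))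
      =O[𝓝 0] fun k : ℝ => k ^ (2 * j + 2)

/-- The leading part of the nonlinearity: either `c_p |x|^p` with `c_p ≠ 0` (real `p`),
or `c_p x^p` with `c_p > 0` and `p` an odd integer. -/
def IsLeadingPart (cp p : ℝ) (np : ℝ → ℝ) : Prop :=
  (cp ≠ 0 ∧ ∀ x : ℝ, np x = cp * |x| ^ p) ∨
    (0 < cp ∧ ∃ q : ℕ, Odd q ∧ p = (q : ℝ) ∧ ∀ x : ℝ, np x = cp * x ^ q)

/-- (A3): `n` is `C²` and `n = n_p + n_r`, where `n_p` is the leading part with exponent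
`p ∈ [2, 4j+1)` and `n_r`, `n_r'` are of higher order at the origin. -/
structure AssumptionA3 (n : ℝ → ℝ) (j : ℕ) (cp p δ : ℝ) (np nr : ℝ → ℝ) : Prop where
  smooth : ContDiff ℝ 2 n
  split : ∀ x : ℝ, n x = np x + nr x
  two_le : 2 ≤ p
  lt_crit : p < 4 * (j : ℝ) + 1
  leading : IsLeadingPart cp p np
  δ_pos : 0 < δ
  higher : nr =O[𝓝 0] fun x : ℝ => |x| ^ (p + δ)
  higher_deriv : deriv nr =O[𝓝 0] fun x : ℝ => |x| ^ (p + δ - 1)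

/-! ### Periodic function spaces -/

/-- Real-valued, `P`-periodic, locally square-integrable functions. -/
def MemL2P (P : ℝ) (u : ℝ → ℝ) : Prop :=
  Function.Periodic u P ∧ MemLp u 2 (volume.restrict (Ioc (-(P / 2)) (P / 2)))

/-- The Fourier coefficients `û_k` in `u(x) = P^{-1/2} ∑ û_k exp(2πikx/P)`. -/
def fourierCoeffP (P : ℝ) (u : ℝ → ℝ) (k : ℤ) : ℂ :=
  ((1 / √P : ℝ) : ℂ) * ∫ x in (-(P / 2))..(P / 2),
    (u x : ℂ) * Complex.exp (-(2 * Real.pi * Complex.I * k * x / P))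

/-- The summands in the squared norm of the periodic Sobolev space of order `s`. -/
def sobolevTerm (P s : ℝ) (u : ℝ → ℝ) (k : ℤ) : ℝ :=
  (1 + 4 * Real.pi ^ 2 * (k : ℝ) ^ 2 / P ^ 2) ^ s * ‖fourierCoeffP P u k‖ ^ 2

/-- Membership in the periodic Sobolev space `H^s_P`, `s ≥ 0`. -/
def MemHP (P s : ℝ) (u : ℝ → ℝ) : Prop :=
  MemL2P P u ∧ Summable (sobolevTerm P s u)

/-- The norm of `H^s_P`. -/
def normHP (P s : ℝ) (u : ℝ → ℝ) : ℝ :=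
  √(∑' k : ℤ, sobolevTerm P s u k)

/-! ### The operator and the functionals -/

/-- The Fourier multiplier `L` with symbol `m` on periodic functions: it multiplies `û_k` by
`m(2πk/P)`. It is applied only to elements of `H^1_P`, for which (`m` being bounded) the
series converges absolutely and uniformly; for even `m` and real `u` its sum is real. -/
def opL (m : ℝ → ℝ) (P : ℝ) (u : ℝ → ℝ) (x : ℝ) : ℝ :=
  (((1 / √P : ℝ) : ℂ) * ∑' k : ℤ, (m (2 * Real.pi * k / P) : ℂ) * fourierCoeffP P u k *
    Complex.exp (2 * Real.pi * Complex.I * k * x / P)).re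

/-- The primitive `N` of `n` that vanishes at the origin. -/
def primitive (n : ℝ → ℝ) (x : ℝ) : ℝ := ∫ s in (0 : ℝ)..x, n s

/-- `Q_P(u) = (1/2) ∫ u²` over one period. -/
def momentum (P : ℝ) (u : ℝ → ℝ) : ℝ :=
  1 / 2 * ∫ x in (-(P / 2))..(P / 2), u x ^ 2

/-- `E_P(u) = -(1/2) ∫ u L u - ∫ N(u)` over one period. -/
def energy (m n : ℝ → ℝ) (P : ℝ) (u : ℝ → ℝ) : ℝ :=
  -(1 / 2 * ∫ x in (-(P / 2))..(P / 2), u x * opL m P u x) -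
    ∫ x in (-(P / 2))..(P / 2), primitive n (u x)

/-- The constraint set `U_{P,μ}`: elements of the open ball of radius `R` in `H^1_P` with
momentum `μ`. -/
def constraintSet (R P μ : ℝ) : Set (ℝ → ℝ) :=
  {u | MemHP P 1 u ∧ normHP P 1 u < R ∧ momentum P u = μ}

/-- `g` is the `L²_P`-derivative at `u` of the functional `F` on `H^1_P`: the Fréchet
derivative of `F` at `u`, with respect to the `H^1_P` norm, is `v ↦ ∫ g v` over one period. -/
def HasL2Derivative (P : ℝ) (F : (ℝ → ℝ) → ℝ) (u g : ℝ → ℝ) : Prop :=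
  MemL2P P g ∧ ∀ ε : ℝ, 0 < ε → ∃ η : ℝ, 0 < η ∧ ∀ v : ℝ → ℝ, MemHP P 1 v →
    normHP P 1 v < η →
      |F (u + v) - F u - ∫ x in (-(P / 2))..(P / 2), g x * v x| ≤ ε * normHP P 1 v

end Whitham

end

namespace Whitham

/-! ### Fourier coefficients of periodic functions -/

/-! On a bounded period $H^1_P$ embeds compactly in $L^2_P$, so the energy attains its minimum on
the part of the closed $H^1$ ball of radius $R$ with momentum $\mu$ (`exists_minimiser_closedBall`).
The real issue is that this minimiser might lie on the boundary sphere; the theorem follows once its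
norm is shown to be of order $\sqrt\mu$, independently of $R$ and $P$.

Three smallness facts drive this. First, interpolation between $L^2$ and $H^1$, with constants
uniform in $P\ge1$, makes every competitor small in sup norm when $\mu$ is small
(`small_of_mem_coeffBall`). Second, near the origin $n$ has a Lipschitz constant $\varepsilon$ as
small as desired (`AssumptionA3.exists_lipschitz`). Third, comparison with a constant function
bounds the energy by $-m(0)\mu+2\varepsilon\mu$, whence $\sum(m(0)-m)|\hat u_k|^2\le
8\varepsilon\mu$ (`tsum_symbol_deficit`). As $m(0)-m\ge d>0$ for $|\xi|\ge1$, most of the momentum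
sits at low frequencies.

The a priori bound `minimiser_normHP_sq_le` tests minimality in the direction $v=\theta(D)u$, where
$\theta$ is a multiple of the indicator of $|\xi|<1$ minus $\xi^2$ on $2\le|\xi|\le X$, balanced so
that $v\perp u$ in $L^2$. Such a $v$ moves mass from high to low frequencies, hence points into the
ball and is admissible even from the boundary (`variational_inequality`). The linear part of the
energy gains about $d$ times the high-frequency part of $\|u'\|^2$. The nonlinear part costs little,
because $n(u)$ has increments at most $\varepsilon$ times those of $u$ (`comp_bounds`). So high
frequencies carry at most one hundredth of $\|u'\|^2$, and the rest is controlled by $\mu$.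

The minimiser is therefore interior, the Lagrange multiplier rule holds (`euler_lagrange`), and
pairing the equation with $u$ places the wave speed near $m(0)$ (`exists_wave_speed`). -/

/-- The measure on one period. -/
noncomputable abbrev periodMeasure (P : ℝ) : Measure ℝ := volume.restrict (Ioc (-(P / 2)) (P / 2))

theorem intervalIntegral_eq_period {P : ℝ} (hP : 0 < P) {E : Type*} [NormedAddCommGroup E]
    [NormedSpace ℝ E] (f : ℝ → E) :
    ∫ x in (-(P / 2))..(P / 2), f x = ∫ x, f x ∂(periodMeasure P) :=
  intervalIntegral.integral_of_le (by linarith)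

theorem MemL2P.add {P : ℝ} {u v : ℝ → ℝ} (hu : MemL2P P u) (hv : MemL2P P v) :
    MemL2P P (u + v) :=
  ⟨hu.1.add hv.1, hu.2.add hv.2⟩

theorem MemL2P.const_smul {P : ℝ} {u : ℝ → ℝ} (c : ℝ) (hu : MemL2P P u) : MemL2P P (c • u) :=
  ⟨fun x => by simp [hu.1 x], hu.2.const_smul c⟩

theorem memL2P_of_continuous {P : ℝ} {u : ℝ → ℝ} (hu : Continuous u)
    (hper : Function.Periodic u P) : MemL2P P u := by
  refine ⟨hper, ?_⟩
  have hsub : Ioc (-(P / 2)) (P / 2) ⊆ Icc (-(P / 2)) (P / 2) := Ioc_subset_Icc_self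
  obtain ⟨C, hC⟩ := isCompact_Icc.exists_bound_of_continuousOn
    (hu.continuousOn (s := Icc (-(P / 2)) (P / 2)))
  refine MemLp.of_bound hu.aestronglyMeasurable C ?_
  exact (ae_restrict_iff' measurableSet_Ioc).2 (Eventually.of_forall fun x hx => hC x (hsub hx))

theorem MemL2P.integrable {P : ℝ} {u : ℝ → ℝ} (hu : MemL2P P u) :
    Integrable u (periodMeasure P) :=
  hu.2.integrable (by norm_num)

theorem MemL2P.integrable_mul {P : ℝ} {u v : ℝ → ℝ} (hu : MemL2P P u) (hv : MemL2P P v) :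
    Integrable (fun x => u x * v x) (periodMeasure P) :=
  hu.2.integrable_mul hv.2

theorem MemL2P.integrable_sq {P : ℝ} {u : ℝ → ℝ} (hu : MemL2P P u) :
    Integrable (fun x => u x ^ 2) (periodMeasure P) := hu.2.integrable_sq

/-- The exponential `exp (2πikx/P)`. -/
noncomputable def wave (P : ℝ) (k : ℤ) (x : ℝ) : ℂ :=
  Complex.exp (2 * Real.pi * Complex.I * k * x / P)

theorem continuous_wave (P : ℝ) (k : ℤ) : Continuous (wave P k) := by
  unfold wave; fun_prop

theorem wave_eq (P : ℝ) (k : ℤ) (x : ℝ) :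
    wave P k x = Complex.exp ((2 * Real.pi * k * x / P : ℝ) * Complex.I) := by
  unfold wave; congr 1; push_cast; ring

theorem norm_wave (P : ℝ) (k : ℤ) (x : ℝ) : ‖wave P k x‖ = 1 := by
  rw [wave_eq, Complex.norm_exp_ofReal_mul_I]

theorem wave_add (P : ℝ) (k : ℤ) (x y : ℝ) : wave P k (x + y) = wave P k x * wave P k y := by
  unfold wave; rw [← Complex.exp_add]; congr 1; push_cast; ring

theorem wave_mul (P : ℝ) (k l : ℤ) (x : ℝ) : wave P k x * wave P l x = wave P (k + l) x := by
  unfold wave; rw [← Complex.exp_add]; congr 1; push_cast; ring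

theorem wave_zero (P : ℝ) (x : ℝ) : wave P 0 x = 1 := by simp [wave]

theorem conj_wave (P : ℝ) (k : ℤ) (x : ℝ) :
    (starRingEnd ℂ) (wave P k x) = wave P (-k) x := by
  unfold wave
  rw [← Complex.exp_conj]
  congr 1
  simp only [map_div₀, map_mul, Complex.conj_ofReal, Complex.conj_I, map_intCast, map_ofNat]
  push_cast
  ring

theorem wave_period {P : ℝ} (hP : 0 < P) (k : ℤ) : wave P k P = 1 := by
  have hP' : (P : ℂ) ≠ 0 := by exact_mod_cast hP.ne'
  unfold wave
  rw [mul_div_assoc, div_self hP', mul_one]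
  rw [show 2 * (Real.pi : ℂ) * Complex.I * k = k * (2 * Real.pi * Complex.I) by ring]
  exact Complex.exp_int_mul_two_pi_mul_I k

theorem wave_periodic {P : ℝ} (hP : 0 < P) (k : ℤ) : Function.Periodic (wave P k) P := fun x => by
  rw [wave_add, wave_period hP, mul_one]

theorem integral_wave {P : ℝ} (hP : 0 < P) (k : ℤ) :
    ∫ x in (-(P / 2))..(P / 2), wave P k x = if k = 0 then (P : ℂ) else 0 := by
  split_ifs with hk
  · subst hk
    simp [wave_zero]
  · have hP' : (P : ℂ) ≠ 0 := by exact_mod_cast hP.ne'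
    have hk' : (k : ℂ) ≠ 0 := by exact_mod_cast hk
    have hc : 2 * Real.pi * Complex.I * k / P ≠ 0 := by
      have hpi : (Real.pi : ℂ) ≠ 0 := by exact_mod_cast Real.pi_ne_zero
      simp [hpi, hk, hP.ne']
    have h := integral_exp_mul_complex (a := -(P / 2)) (b := P / 2) hc
    have h2 : ∀ x : ℝ, Complex.exp (2 * Real.pi * Complex.I * k / P * x) = wave P k x := by
      intro x; unfold wave; congr 1; ring
    simp only [h2] at h
    have h3 := wave_periodic hP k (-(P / 2))
    rw [show -(P / 2) + P = P / 2 by ring] at h3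
    rw [h, h3, sub_self, zero_div]

theorem fourierCoeffP_eq_wave (P : ℝ) (u : ℝ → ℝ) (k : ℤ) :
    fourierCoeffP P u k =
      ((1 / √P : ℝ) : ℂ) * ∫ x in (-(P / 2))..(P / 2), (u x : ℂ) * wave P (-k) x := by
  unfold fourierCoeffP wave
  congr 3
  ext x; congr 2; push_cast; ring

theorem fourierCoeffP_eq_fourierCoeffOn {P : ℝ} (hP : 0 < P) (u : ℝ → ℝ) (k : ℤ) :
    fourierCoeffP P u k = (√P : ℝ) *
      fourierCoeffOn (show -(P / 2) < P / 2 by linarith) (fun x => (u x : ℂ)) k := by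
  have hs : √P ≠ 0 := (Real.sqrt_pos.2 hP).ne'
  have hs2 : √P * √P = P := Real.mul_self_sqrt hP.le
  rw [fourierCoeffOn_eq_integral, fourierCoeffP_eq_wave]
  have e : P / 2 - -(P / 2) = P := by ring
  have h1 : ∀ x : ℝ, (fourier (-k)) (x : AddCircle (P / 2 - -(P / 2))) = wave P (-k) x := by
    intro x
    rw [fourier_coe_apply, wave, e]
  simp only [h1]
  rw [e, Complex.real_smul, ← mul_assoc]
  congr 1
  · rw [← Complex.ofReal_mul]
    congr 1
    field_simp
    rw [sq, hs2]
  · congr 1; ext x; simp [mul_comm]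

theorem hasSum_of_eq {ι : Type*} {f g : ι → ℝ} {a b : ℝ} (h : HasSum f a) (hf : ∀ k, g k = f k)
    (hab : b = a) : HasSum g b := by
  rwa [funext hf, hab]

theorem MemL2P.hasSum_sq {P : ℝ} (hP : 0 < P) {u : ℝ → ℝ} (hu : MemL2P P u) :
    HasSum (fun k => ‖fourierCoeffP P u k‖ ^ 2) (∫ x in (-(P / 2))..(P / 2), u x ^ 2) := by
  have h := hasSum_sq_fourierCoeffOn (f := fun x => (u x : ℂ)) (show -(P / 2) < P / 2 by linarith)
    hu.2.ofReal
  have h2 := h.mul_left P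
  have e : P / 2 - -(P / 2) = P := by ring
  refine hasSum_of_eq h2 (fun k => ?_) ?_
  · rw [fourierCoeffP_eq_fourierCoeffOn hP, norm_mul, mul_pow, Complex.norm_real,
      Real.norm_of_nonneg (Real.sqrt_nonneg P), Real.sq_sqrt hP.le]
  · rw [e, smul_eq_mul, ← mul_assoc, mul_inv_cancel₀ hP.ne', one_mul]
    simp

theorem MemL2P.integrable_mul_wave {P : ℝ} {u : ℝ → ℝ} (hu : MemL2P P u) (k : ℤ) :
    Integrable (fun x => (u x : ℂ) * wave P k x) (periodMeasure P) :=
  hu.integrable.ofReal.mul_bdd (c := 1) (continuous_wave P k).aestronglyMeasurable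
    (Eventually.of_forall fun x => (norm_wave P k x).le)

theorem fourierCoeffP_add {P : ℝ} (hP : 0 < P) {u v : ℝ → ℝ} (hu : MemL2P P u)
    (hv : MemL2P P v) (k : ℤ) :
    fourierCoeffP P (u + v) k = fourierCoeffP P u k + fourierCoeffP P v k := by
  simp only [fourierCoeffP_eq_wave, intervalIntegral_eq_period hP]
  rw [← mul_add, ← integral_add (hu.integrable_mul_wave _) (hv.integrable_mul_wave _)]
  simp [add_mul]

theorem fourierCoeffP_const_smul (P c : ℝ) (u : ℝ → ℝ) (k : ℤ) :
    fourierCoeffP P (c • u) k = c * fourierCoeffP P u k := by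
  simp only [fourierCoeffP_eq_wave]
  rw [mul_left_comm, ← intervalIntegral.integral_const_mul]
  simp [mul_assoc]

theorem fourierCoeffP_neg (P : ℝ) (u : ℝ → ℝ) (k : ℤ) :
    fourierCoeffP P u (-k) = (starRingEnd ℂ) (fourierCoeffP P u k) := by
  simp only [fourierCoeffP_eq_wave, map_mul, Complex.conj_ofReal]
  congr 1
  simp only [intervalIntegral]
  rw [map_sub, ← integral_conj, ← integral_conj]
  simp [conj_wave, Complex.conj_ofReal]

/-- Polarisation of Parseval's identity: a quarter of the difference between the squares of $u+v$
and $u-v$. -/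
theorem MemL2P.hasSum_inner {P : ℝ} (hP : 0 < P) {u v : ℝ → ℝ} (hu : MemL2P P u)
    (hv : MemL2P P v) :
    HasSum (fun k => (fourierCoeffP P u k * (starRingEnd ℂ) (fourierCoeffP P v k)).re)
      (∫ x in (-(P / 2))..(P / 2), u x * v x) := by
  have h1 := (hu.add hv).hasSum_sq hP
  have h2 := (hu.add (hv.const_smul (-1))).hasSum_sq hP
  have h3 := (h1.sub h2).mul_left (1 / 4)
  refine hasSum_of_eq h3 (fun k => ?_) ?_
  · rw [fourierCoeffP_add hP hu hv, fourierCoeffP_add hP hu (hv.const_smul (-1)),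
      fourierCoeffP_const_smul]
    rw [← Complex.normSq_eq_norm_sq, ← Complex.normSq_eq_norm_sq]
    simp [Complex.normSq_apply]
    ring
  · simp only [intervalIntegral_eq_period hP]
    rw [← integral_sub (hu.add hv).integrable_sq (hu.add (hv.const_smul (-1))).integrable_sq,
      ← integral_const_mul]
    congr 1
    ext x
    simp
    ring

theorem ae_eq_of_fourierCoeffP_eq {P : ℝ} (hP : 0 < P) {u v : ℝ → ℝ} (hu : MemL2P P u)
    (hv : MemL2P P v) (h : ∀ k, fourierCoeffP P u k = fourierCoeffP P v k) :
    u =ᵐ[periodMeasure P] v := by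
  have hw := hu.add (hv.const_smul (-1))
  have h1 := hw.hasSum_sq hP
  have h2 : ∀ k, ‖fourierCoeffP P (u + (-1 : ℝ) • v) k‖ ^ 2 = 0 := by
    intro k
    rw [fourierCoeffP_add hP hu (hv.const_smul _), fourierCoeffP_const_smul, h]
    simp
  simp only [h2] at h1
  have h3 := h1.unique hasSum_zero
  rw [intervalIntegral_eq_period hP, integral_eq_zero_iff_of_nonneg (fun x => sq_nonneg _)
    hw.integrable_sq] at h3
  filter_upwards [h3] with x hx
  have : u x + -v x = 0 := by simpa using hx
  linarith

/-- A continuous periodic function is determined by its Fourier coefficients. -/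
theorem eq_of_fourierCoeffP_eq {P : ℝ} (hP : 0 < P) {u v : ℝ → ℝ} (hu : MemL2P P u)
    (hv : MemL2P P v) (huc : Continuous u) (hvc : Continuous v)
    (h : ∀ k, fourierCoeffP P u k = fourierCoeffP P v k) : u = v := by
  have h1 := ae_eq_of_fourierCoeffP_eq hP hu hv h
  have h2 : EqOn u v (Ioc (-(P / 2)) (P / 2)) := by
    have h3 : u =ᵐ[volume.restrict (Ioo (-(P / 2)) (P / 2))] v :=
      ae_restrict_of_ae_restrict_of_subset Ioo_subset_Ioc_self h1
    have h4 := Measure.eqOn_Ioo_of_ae_eq volume h3 huc.continuousOn hvc.continuousOn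
    have h5 := h4.closure huc hvc
    rw [closure_Ioo (by linarith)] at h5
    exact h5.mono Ioc_subset_Icc_self
  ext x
  have : (u - v) x = 0 := by
    obtain ⟨y, hy, hxy⟩ := (hu.1.sub hv.1).exists_mem_Ioc hP x (-(P / 2))
    rw [hxy, Pi.sub_apply, h2 ⟨hy.1, by linarith [hy.2]⟩, sub_self]
  simpa [sub_eq_zero] using this

theorem fourierCoeffP_translate {P : ℝ} (hP : 0 < P) {u : ℝ → ℝ} (hu : Function.Periodic u P)
    (h : ℝ) (k : ℤ) :
    fourierCoeffP P (fun x => u (x + h)) k = wave P k h * fourierCoeffP P u k := by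
  simp only [fourierCoeffP_eq_wave]
  rw [mul_left_comm]
  congr 1
  have h1 : ∀ x, (u (x + h) : ℂ) * wave P (-k) x =
      wave P k h * ((u (x + h) : ℂ) * wave P (-k) (x + h)) := by
    intro x
    have : wave P k h * wave P (-k) h = 1 := by rw [wave_mul]; simp [wave_zero]
    rw [wave_add]
    linear_combination -(↑(u (x + h)) * wave P (-k) x) * this
  simp only [h1]
  rw [intervalIntegral.integral_const_mul,
    intervalIntegral.integral_comp_add_right (fun x => (u x : ℂ) * wave P (-k) x) h]
  congr 1
  have hper : Function.Periodic (fun x => (u x : ℂ) * wave P (-k) x) P := fun x => by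
    simp only [hu x, wave_periodic hP (-k) x]
  have := hper.intervalIntegral_add_eq (-(P / 2) + h) (-(P / 2))
  rw [show -(P / 2) + h + P = P / 2 + h by ring, show -(P / 2) + P = P / 2 by ring] at this
  exact this

/-! ### Fourier synthesis -/

/-- The Fourier series with coefficients `a`. -/
noncomputable def synth (P : ℝ) (a : ℤ → ℂ) (x : ℝ) : ℝ :=
  (((1 / √P : ℝ) : ℂ) * ∑' k : ℤ, a k * wave P k x).re

theorem opL_eq_synth (m : ℝ → ℝ) (P : ℝ) (u : ℝ → ℝ) :
    opL m P u = synth P fun k => (m (2 * Real.pi * k / P) : ℂ) * fourierCoeffP P u k := rfl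

theorem norm_mul_wave (P : ℝ) (a : ℤ → ℂ) (k : ℤ) (x : ℝ) : ‖a k * wave P k x‖ = ‖a k‖ := by
  rw [norm_mul, norm_wave, mul_one]

theorem summable_mul_wave {P : ℝ} {a : ℤ → ℂ} (ha : Summable fun k => ‖a k‖) (x : ℝ) :
    Summable fun k => a k * wave P k x :=
  Summable.of_norm (by simpa only [norm_mul_wave] using ha)

theorem continuous_synth {P : ℝ} {a : ℤ → ℂ} (ha : Summable fun k => ‖a k‖) :
    Continuous (synth P a) := by
  unfold synth
  have : Continuous fun x => ∑' k : ℤ, a k * wave P k x :=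
    continuous_tsum (fun k => continuous_const.mul (continuous_wave P k)) ha
      (fun k x => (norm_mul_wave P a k x).le)
  fun_prop

theorem synth_periodic {P : ℝ} (hP : 0 < P) (a : ℤ → ℂ) : Function.Periodic (synth P a) P :=
  fun x => by simp only [synth, wave_periodic hP _ x]

theorem memL2P_synth {P : ℝ} (hP : 0 < P) {a : ℤ → ℂ} (ha : Summable fun k => ‖a k‖) :
    MemL2P P (synth P a) :=
  memL2P_of_continuous (continuous_synth ha) (synth_periodic hP a)

theorem abs_synth_le {P : ℝ} {a : ℤ → ℂ} (ha : Summable fun k => ‖a k‖) (x : ℝ) :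
    |synth P a x| ≤ 1 / √P * ∑' k, ‖a k‖ := by
  refine (Complex.abs_re_le_norm _).trans ?_
  rw [norm_mul, Complex.norm_real, Real.norm_of_nonneg (by positivity)]
  gcongr
  refine tsum_of_norm_bounded ha.hasSum fun k => (norm_mul_wave P a k x).le

/-- Hermitian symmetry makes the series invariant under conjugation, so the real part taken in
`synth` discards nothing. -/
theorem ofReal_synth {P : ℝ} {a : ℤ → ℂ} (hsym : ∀ k, a (-k) = (starRingEnd ℂ) (a k)) (x : ℝ) :
    (synth P a x : ℂ) = ((1 / √P : ℝ) : ℂ) * ∑' k : ℤ, a k * wave P k x := by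
  unfold synth
  rw [← Complex.conj_eq_iff_re, map_mul, Complex.conj_ofReal, Complex.conj_tsum]
  congr 1
  rw [← (Equiv.neg ℤ).tsum_eq]
  congr 1
  ext k
  simp [hsym, conj_wave]

theorem fourierCoeffP_synth {P : ℝ} (hP : 0 < P) {a : ℤ → ℂ} (ha : Summable fun k => ‖a k‖)
    (hsym : ∀ k, a (-k) = (starRingEnd ℂ) (a k)) (j : ℤ) :
    fourierCoeffP P (synth P a) j = a j := by
  rw [fourierCoeffP_eq_wave]
  simp only [ofReal_synth hsym, mul_assoc]
  rw [intervalIntegral.integral_const_mul, ← mul_assoc]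
  have h1 : HasSum (fun k => ∫ x in (-(P / 2))..(P / 2), a k * wave P (k + -j) x)
      (∫ x in (-(P / 2))..(P / 2), (∑' k : ℤ, a k * wave P k x) * wave P (-j) x) := by
    refine intervalIntegral.hasSum_integral_of_dominated_convergence (fun k _ => ‖a k‖)
      (fun k => (continuous_const.mul (continuous_wave P _)).aestronglyMeasurable)
      (fun k => Eventually.of_forall fun x _ => (norm_mul_wave P (fun _ => a k) _ x).le)
      (Eventually.of_forall fun x _ => ha) ?_ ?_
    · simp
    · refine Eventually.of_forall fun x _ => ?_
      have := (summable_mul_wave (P := P) ha x).hasSum.mul_right (wave P (-j) x)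
      simpa only [mul_assoc, wave_mul] using this
  rw [← h1.tsum_eq]
  simp only [intervalIntegral.integral_const_mul, integral_wave hP]
  rw [tsum_eq_single j]
  · have : √P * √P = P := Real.mul_self_sqrt hP.le
    have hs : √P ≠ 0 := (Real.sqrt_pos.2 hP).ne'
    simp only [add_neg_cancel, if_true]
    rw [← Complex.ofReal_mul, mul_left_comm, ← Complex.ofReal_mul]
    rw [show 1 / √P * (1 / √P) * P = 1 by field_simp; rw [sq, this]]
    simp
  · intro k hk
    rw [if_neg (by omega), mul_zero]

/-! ### Weighted sequences -/

/-- The frequency `2πk/P`. -/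
noncomputable abbrev freq (P : ℝ) (k : ℤ) : ℝ := 2 * Real.pi * k / P

theorem sobolevTerm_one (P : ℝ) (u : ℝ → ℝ) (k : ℤ) :
    sobolevTerm P 1 u k = (1 + freq P k ^ 2) * ‖fourierCoeffP P u k‖ ^ 2 := by
  unfold sobolevTerm freq
  rw [Real.rpow_one]
  congr 2
  ring

/-- The linear dependence on $1/a$ matters: with $a$ proportional to $\tau/P$ the sum grows like
$P/\tau$, and the normalisation $1/\sqrt P$, once squared, cancels that growth. -/
theorem sum_range_inv_one_add_sq_le {a : ℝ} (ha : 0 < a) (N : ℕ) :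
    ∑ n ∈ Finset.range N, 1 / (1 + a ^ 2 * (n : ℝ) ^ 2) ≤ 1 + 2 / a := by
  -- The subtracted term makes the induction telescope. With $y=a(N+1)$ the step reduces to
  -- $(1+y)^2\le2(1+y^2)$.
  have key : ∀ N : ℕ, ∑ n ∈ Finset.range (N + 1), 1 / (1 + a ^ 2 * (n : ℝ) ^ 2) ≤
      1 + 2 / a - 2 / (a * (1 + a * N)) := by
    intro N
    induction N with
    | zero => simp
    | succ N ih =>
      rw [Finset.sum_range_succ]
      have h : 1 / (1 + a ^ 2 * ((N + 1 : ℕ) : ℝ) ^ 2) ≤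
          2 / (a * (1 + a * N)) - 2 / (a * (1 + a * ((N + 1 : ℕ) : ℝ))) := by
        push_cast
        have h0 : (0 : ℝ) ≤ N := N.cast_nonneg
        have e : 2 / (a * (1 + a * N)) - 2 / (a * (1 + a * ((N : ℝ) + 1))) =
            2 / ((1 + a * N) * (1 + a * ((N : ℝ) + 1))) := by
          field_simp
          ring
        rw [e, div_le_div_iff₀ (by positivity) (by positivity)]
        nlinarith [sq_nonneg (1 - a * ((N : ℝ) + 1)), mul_nonneg ha.le h0]
      linarith
  rcases N with _ | N
  · simp; positivity
  · refine (key N).trans ?_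
    have : 0 < 2 / (a * (1 + a * (N : ℝ))) := by positivity
    linarith

theorem summable_inv_one_add_sq {a : ℝ} (ha : 0 < a) :
    Summable (fun k : ℤ => 1 / (1 + a ^ 2 * (k : ℝ) ^ 2)) ∧
      ∑' k : ℤ, 1 / (1 + a ^ 2 * (k : ℝ) ^ 2) ≤ 2 + 4 / a := by
  have hs : Summable fun n : ℕ => 1 / (1 + a ^ 2 * (n : ℝ) ^ 2) :=
    summable_of_sum_range_le (fun n => by positivity) (sum_range_inv_one_add_sq_le ha)
  have hle : ∑' n : ℕ, 1 / (1 + a ^ 2 * (n : ℝ) ^ 2) ≤ 1 + 2 / a :=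
    Real.tsum_le_of_sum_range_le (fun n => by positivity) (sum_range_inv_one_add_sq_le ha)
  have h := HasSum.of_nat_of_neg (f := fun k : ℤ => 1 / (1 + a ^ 2 * (k : ℝ) ^ 2))
    (by simpa using hs.hasSum) (by simpa using hs.hasSum)
  refine ⟨h.summable, ?_⟩
  rw [h.tsum_eq]
  have : 4 / a = 2 * (2 / a) := by ring
  simp only [one_div] at hle
  simp
  linarith

/-- The Cauchy–Schwarz inequality for series. -/
theorem summable_mul_of_sq {ι : Type*} {f g : ι → ℝ} (hf : Summable fun k => f k ^ 2)
    (hg : Summable fun k => g k ^ 2) :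
    Summable (fun k => |f k * g k|) ∧
      ∑' k, |f k * g k| ≤ √(∑' k, f k ^ 2) * √(∑' k, g k ^ 2) := by
  have h : ∀ s : Finset ι, ∑ k ∈ s, |f k * g k| ≤ √(∑' k, f k ^ 2) * √(∑' k, g k ^ 2) := by
    intro s
    simp only [abs_mul]
    refine (Real.sum_mul_le_sqrt_mul_sqrt s _ _).trans ?_
    simp only [sq_abs]
    gcongr
    · exact hf.sum_le_tsum s fun _ _ => sq_nonneg _
    · exact hg.sum_le_tsum s fun _ _ => sq_nonneg _
  exact ⟨summable_of_sum_le (fun _ => abs_nonneg _) h,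
    Real.tsum_le_of_sum_le (fun _ => abs_nonneg _) h⟩

theorem summable_inv_freq {P τ : ℝ} (hP : 0 < P) (hτ : 0 < τ) :
    Summable (fun k : ℤ => 1 / (1 + τ ^ 2 * freq P k ^ 2)) ∧
      ∑' k : ℤ, 1 / (1 + τ ^ 2 * freq P k ^ 2) ≤ 2 + P / τ := by
  have ha : 0 < 2 * Real.pi * τ / P := by positivity
  have h := summable_inv_one_add_sq ha
  have e : ∀ k : ℤ, 1 / (1 + τ ^ 2 * freq P k ^ 2) =
      1 / (1 + (2 * Real.pi * τ / P) ^ 2 * (k : ℝ) ^ 2) := by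
    intro k; congr 2; unfold freq; ring
  simp only [e]
  refine ⟨h.1, h.2.trans ?_⟩
  have : 4 / (2 * Real.pi * τ / P) = P / τ * (2 / Real.pi) := by field_simp; ring
  rw [this]
  have h2 : 2 / Real.pi ≤ 1 := by
    rw [div_le_one Real.pi_pos]; exact Real.two_le_pi
  have : P / τ * (2 / Real.pi) ≤ P / τ * 1 := by gcongr
  linarith

/-- Interpolated bound for the absolute sum of a sequence by its `ℓ²` norm and the `ℓ²` norm of
the derivative; it is uniform in the period. -/
theorem sq_sum_norm_le {P τ : ℝ} (hP : 1 ≤ P) (hτ : 0 < τ) (hτ1 : τ ≤ 1) {a : ℤ → ℂ}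
    (h0 : Summable fun k => ‖a k‖ ^ 2) (h1 : Summable fun k => freq P k ^ 2 * ‖a k‖ ^ 2) :
    Summable (fun k => ‖a k‖) ∧ (1 / √P * ∑' k, ‖a k‖) ^ 2 ≤
      3 / τ * (∑' k, ‖a k‖ ^ 2 + τ ^ 2 * ∑' k, freq P k ^ 2 * ‖a k‖ ^ 2) := by
  have hP0 : 0 < P := by linarith
  have hw : ∀ k, 0 < 1 + τ ^ 2 * freq P k ^ 2 := fun k => by positivity
  have hs := summable_inv_freq hP0 hτ
  -- Cauchy–Schwarz after inserting the weight $1+\tau^2\xi^2$ and its inverse; $\tau$ tunes the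
  -- balance between the $L^2$ part and the derivative.
  have e1 : ∀ k, 1 / (1 + τ ^ 2 * freq P k ^ 2) = (1 / √(1 + τ ^ 2 * freq P k ^ 2)) ^ 2 := by
    intro k; rw [one_div_pow, Real.sq_sqrt (hw k).le]
  have e2 : ∀ k, ‖a k‖ ^ 2 + τ ^ 2 * (freq P k ^ 2 * ‖a k‖ ^ 2) =
      (√(1 + τ ^ 2 * freq P k ^ 2) * ‖a k‖) ^ 2 := by
    intro k; rw [mul_pow, Real.sq_sqrt (hw k).le]; ring
  have e3 : ∀ k, |1 / √(1 + τ ^ 2 * freq P k ^ 2) * (√(1 + τ ^ 2 * freq P k ^ 2) * ‖a k‖)|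
      = ‖a k‖ := by
    intro k
    have := (Real.sqrt_pos.2 (hw k)).ne'
    rw [← mul_assoc, one_div_mul_cancel this, one_mul, abs_norm]
  have h2 := h0.add (h1.mul_left (τ ^ 2))
  have h3 := h0.tsum_add (h1.mul_left (τ ^ 2))
  rw [tsum_mul_left] at h3
  simp only [e2] at h2 h3
  simp only [e1] at hs
  have h4 := summable_mul_of_sq hs.1 h2
  simp only [e3] at h4
  refine ⟨h4.1, ?_⟩
  rw [← h3, mul_pow, div_pow, one_pow, Real.sq_sqrt hP0.le]
  have h5 : (∑' k, ‖a k‖) ^ 2 ≤ (2 + P / τ) *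
      ∑' k, (√(1 + τ ^ 2 * freq P k ^ 2) * ‖a k‖) ^ 2 := by
    have h6 := pow_le_pow_left₀ (tsum_nonneg fun _ => norm_nonneg _) h4.2 2
    rw [mul_pow, Real.sq_sqrt (tsum_nonneg fun _ => sq_nonneg _),
      Real.sq_sqrt (tsum_nonneg fun _ => sq_nonneg _)] at h6
    refine h6.trans ?_
    gcongr
    exact hs.2
  calc 1 / P * (∑' k, ‖a k‖) ^ 2 ≤ 1 / P * ((2 + P / τ) *
        ∑' k, (√(1 + τ ^ 2 * freq P k ^ 2) * ‖a k‖) ^ 2) := by gcongr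
    _ = (2 / P + 1 / τ) * ∑' k, (√(1 + τ ^ 2 * freq P k ^ 2) * ‖a k‖) ^ 2 := by
        field_simp
    _ ≤ 3 / τ * ∑' k, (√(1 + τ ^ 2 * freq P k ^ 2) * ‖a k‖) ^ 2 := by
        gcongr
        have h7 : 2 / P ≤ 2 / τ := by gcongr; linarith
        have : 3 / τ = 2 / τ + 1 / τ := by ring
        linarith

/-! ### The periodic Sobolev space of order one -/

theorem memHP_one_iff {P : ℝ} {u : ℝ → ℝ} :
    MemHP P 1 u ↔ MemL2P P u ∧
      Summable fun k => (1 + freq P k ^ 2) * ‖fourierCoeffP P u k‖ ^ 2 := by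
  unfold MemHP
  rw [show sobolevTerm P 1 u = _ from funext (sobolevTerm_one P u)]

theorem normHP_nonneg (P : ℝ) (u : ℝ → ℝ) : 0 ≤ normHP P 1 u := Real.sqrt_nonneg _

theorem normHP_sq (P : ℝ) (u : ℝ → ℝ) :
    normHP P 1 u ^ 2 = ∑' k, (1 + freq P k ^ 2) * ‖fourierCoeffP P u k‖ ^ 2 := by
  unfold normHP
  rw [show sobolevTerm P 1 u = _ from funext (sobolevTerm_one P u), Real.sq_sqrt]
  exact tsum_nonneg fun k => by positivity

theorem summable_norm_sq_of_weighted {P : ℝ} {a : ℤ → ℂ}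
    (h : Summable fun k => (1 + freq P k ^ 2) * ‖a k‖ ^ 2) : Summable fun k => ‖a k‖ ^ 2 := by
  refine h.of_nonneg_of_le (fun k => by positivity) fun k => ?_
  nlinarith [mul_nonneg (sq_nonneg (freq P k)) (sq_nonneg ‖a k‖)]

theorem summable_freq_sq_of_weighted {P : ℝ} {a : ℤ → ℂ}
    (h : Summable fun k => (1 + freq P k ^ 2) * ‖a k‖ ^ 2) :
    Summable fun k => freq P k ^ 2 * ‖a k‖ ^ 2 := by
  refine h.of_nonneg_of_le (fun k => by positivity) fun k => ?_
  nlinarith [sq_nonneg ‖a k‖]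

theorem tsum_weighted {P : ℝ} {a : ℤ → ℂ}
    (h : Summable fun k => (1 + freq P k ^ 2) * ‖a k‖ ^ 2) :
    ∑' k, (1 + freq P k ^ 2) * ‖a k‖ ^ 2 =
      ∑' k, ‖a k‖ ^ 2 + ∑' k, freq P k ^ 2 * ‖a k‖ ^ 2 := by
  rw [← (summable_norm_sq_of_weighted h).tsum_add (summable_freq_sq_of_weighted h)]
  congr 1; ext k; ring

theorem summable_norm_of_weighted {P : ℝ} (hP : 1 ≤ P) {a : ℤ → ℂ}
    (h : Summable fun k => (1 + freq P k ^ 2) * ‖a k‖ ^ 2) : Summable fun k => ‖a k‖ :=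
  (sq_sum_norm_le hP one_pos le_rfl (summable_norm_sq_of_weighted h)
    (summable_freq_sq_of_weighted h)).1

/-- Sobolev embedding with a constant which is uniform in the period. -/
theorem sum_norm_le_of_weighted {P : ℝ} (hP : 1 ≤ P) {a : ℤ → ℂ}
    (h : Summable fun k => (1 + freq P k ^ 2) * ‖a k‖ ^ 2) :
    (1 / √P * ∑' k, ‖a k‖) ^ 2 ≤ 3 * ∑' k, (1 + freq P k ^ 2) * ‖a k‖ ^ 2 := by
  rw [tsum_weighted h]
  simpa using (sq_sum_norm_le hP one_pos le_rfl (summable_norm_sq_of_weighted h)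
    (summable_freq_sq_of_weighted h)).2

theorem MemHP.weighted {P : ℝ} {u : ℝ → ℝ} (hu : MemHP P 1 u) :
    Summable fun k => (1 + freq P k ^ 2) * ‖fourierCoeffP P u k‖ ^ 2 :=
  (memHP_one_iff.1 hu).2

theorem memHP_synth {P : ℝ} (hP : 1 ≤ P) {a : ℤ → ℂ}
    (h : Summable fun k => (1 + freq P k ^ 2) * ‖a k‖ ^ 2)
    (hsym : ∀ k, a (-k) = (starRingEnd ℂ) (a k)) : MemHP P 1 (synth P a) := by
  have hs := summable_norm_of_weighted hP h
  refine memHP_one_iff.2 ⟨memL2P_synth (by linarith) hs, ?_⟩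
  simpa only [fourierCoeffP_synth (by linarith : 0 < P) hs hsym] using h

theorem MemHP.add {P : ℝ} (hP : 0 < P) {u v : ℝ → ℝ} (hu : MemHP P 1 u) (hv : MemHP P 1 v) :
    MemHP P 1 (u + v) := by
  refine memHP_one_iff.2 ⟨hu.1.add hv.1, ?_⟩
  refine ((hu.weighted.add hv.weighted).mul_left 2).of_nonneg_of_le (fun k => by positivity)
    fun k => ?_
  rw [fourierCoeffP_add hP hu.1 hv.1]
  have h1 := pow_le_pow_left₀ (norm_nonneg _) (norm_add_le (fourierCoeffP P u k)
    (fourierCoeffP P v k)) 2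
  have h2 := add_sq_le (a := ‖fourierCoeffP P u k‖) (b := ‖fourierCoeffP P v k‖)
  have h3 : 0 ≤ 1 + freq P k ^ 2 := by positivity
  calc _ ≤ (1 + freq P k ^ 2) * (2 * (‖fourierCoeffP P u k‖ ^ 2 + ‖fourierCoeffP P v k‖ ^ 2)) := by
        gcongr; linarith
    _ = _ := by ring

theorem MemHP.const_smul {P : ℝ} {u : ℝ → ℝ} (c : ℝ) (hu : MemHP P 1 u) :
    MemHP P 1 (c • u) := by
  refine memHP_one_iff.2 ⟨hu.1.const_smul c, ?_⟩
  refine (hu.weighted.mul_left (c ^ 2)).congr fun k => ?_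
  rw [fourierCoeffP_const_smul, norm_mul, Complex.norm_real, mul_pow, Real.norm_eq_abs, sq_abs]
  ring

theorem normHP_const_smul (P c : ℝ) (u : ℝ → ℝ) : normHP P 1 (c • u) = |c| * normHP P 1 u := by
  rw [← sq_eq_sq₀ (normHP_nonneg _ _) (mul_nonneg (abs_nonneg _) (normHP_nonneg _ _)), mul_pow,
    normHP_sq, normHP_sq, ← tsum_mul_left]
  congr 1; ext k
  rw [fourierCoeffP_const_smul, norm_mul, Complex.norm_real, mul_pow, Real.norm_eq_abs]
  ring

/-- Elements of $H^1_P$ are genuine functions here, not classes. The Fourier series is the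
continuous representative, so pointwise bounds on a general element hold only almost everywhere. -/
theorem MemHP.ae_eq_synth {P : ℝ} (hP : 1 ≤ P) {u : ℝ → ℝ} (hu : MemHP P 1 u) :
    u =ᵐ[periodMeasure P] synth P (fourierCoeffP P u) := by
  have hP0 : 0 < P := by linarith
  have hs := summable_norm_of_weighted hP hu.weighted
  exact ae_eq_of_fourierCoeffP_eq hP0 hu.1 (memL2P_synth hP0 hs) fun k =>
    (fourierCoeffP_synth hP0 hs (fourierCoeffP_neg P u) k).symm

theorem MemHP.ae_abs_le {P : ℝ} (hP : 1 ≤ P) {u : ℝ → ℝ} (hu : MemHP P 1 u) :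
    ∀ᵐ x ∂(periodMeasure P), |u x| ≤ 1 / √P * ∑' k, ‖fourierCoeffP P u k‖ := by
  filter_upwards [hu.ae_eq_synth hP] with x hx
  rw [hx]
  exact abs_synth_le (summable_norm_of_weighted hP hu.weighted) x

theorem MemHP.ae_abs_le_normHP {P : ℝ} (hP : 1 ≤ P) {u : ℝ → ℝ} (hu : MemHP P 1 u) :
    ∀ᵐ x ∂(periodMeasure P), |u x| ≤ 2 * normHP P 1 u := by
  filter_upwards [hu.ae_abs_le hP] with x hx
  refine hx.trans (abs_le_of_sq_le_sq' ?_ (by have := normHP_nonneg P u; positivity)).2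
  refine (sum_norm_le_of_weighted hP hu.weighted).trans ?_
  rw [mul_pow, normHP_sq]
  have : 0 ≤ ∑' k, (1 + freq P k ^ 2) * ‖fourierCoeffP P u k‖ ^ 2 :=
    tsum_nonneg fun k => by positivity
  linarith

theorem MemHP.tsum_sq_le {P : ℝ} {u : ℝ → ℝ} (hu : MemHP P 1 u) :
    ∑' k, ‖fourierCoeffP P u k‖ ^ 2 ≤ normHP P 1 u ^ 2 := by
  rw [normHP_sq, tsum_weighted hu.weighted]
  have : 0 ≤ ∑' k, freq P k ^ 2 * ‖fourierCoeffP P u k‖ ^ 2 :=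
    tsum_nonneg fun k => by positivity
  linarith

theorem momentum_eq {P : ℝ} (hP : 0 < P) {u : ℝ → ℝ} (hu : MemL2P P u) :
    momentum P u = 1 / 2 * ∑' k, ‖fourierCoeffP P u k‖ ^ 2 := by
  rw [momentum, (hu.hasSum_sq hP).tsum_eq]

/-! ### The Fourier multiplier -/

/-- Boundedness of the symbol preserves the weighted sum, and evenness preserves Hermitian symmetry.
Continuity of the symbol is not required, so the lemma also serves the discontinuous cut-off
multiplier of the a priori bound. -/
theorem memHP_opL {m : ℝ → ℝ} {M P : ℝ} (hP : 1 ≤ P) (hm : ∀ ξ, |m ξ| ≤ M)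
    (heven : ∀ ξ, m (-ξ) = m ξ) {u : ℝ → ℝ} (hu : MemHP P 1 u) :
    MemHP P 1 (opL m P u) ∧ Continuous (opL m P u) ∧
      ∀ k, fourierCoeffP P (opL m P u) k = m (freq P k) * fourierCoeffP P u k := by
  rw [opL_eq_synth]
  have h1 : Summable fun k => (1 + freq P k ^ 2) *
      ‖(m (2 * Real.pi * k / P) : ℂ) * fourierCoeffP P u k‖ ^ 2 := by
    refine (hu.weighted.mul_left (M ^ 2)).of_nonneg_of_le (fun k => by positivity) fun k => ?_
    rw [norm_mul, Complex.norm_real, Real.norm_eq_abs, mul_pow]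
    have := pow_le_pow_left₀ (abs_nonneg _) (hm (2 * Real.pi * k / P)) 2
    calc _ ≤ (1 + freq P k ^ 2) * (M ^ 2 * ‖fourierCoeffP P u k‖ ^ 2) := by gcongr
      _ = _ := by ring
  have hsym : ∀ k : ℤ, (m (2 * Real.pi * (-k : ℤ) / P) : ℂ) * fourierCoeffP P u (-k) =
      (starRingEnd ℂ) ((m (2 * Real.pi * k / P) : ℂ) * fourierCoeffP P u k) := by
    intro k
    rw [map_mul, Complex.conj_ofReal, fourierCoeffP_neg, ← heven]
    congr 3; push_cast; ring
  have hs := summable_norm_of_weighted hP h1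
  exact ⟨memHP_synth hP h1 hsym, continuous_synth hs,
    fourierCoeffP_synth (by linarith) hs hsym⟩

theorem hasSum_mul_opL {m : ℝ → ℝ} {M P : ℝ} (hP : 1 ≤ P) (hm : ∀ ξ, |m ξ| ≤ M)
    (heven : ∀ ξ, m (-ξ) = m ξ) {u v : ℝ → ℝ} (hu : MemHP P 1 u) (hv : MemL2P P v) :
    HasSum (fun k => m (freq P k) *
      (fourierCoeffP P u k * (starRingEnd ℂ) (fourierCoeffP P v k)).re)
      (∫ x in (-(P / 2))..(P / 2), opL m P u x * v x) := by
  obtain ⟨h1, -, h2⟩ := memHP_opL hP hm heven hu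
  refine hasSum_of_eq (h1.1.hasSum_inner (by linarith) hv) (fun k => ?_) rfl
  rw [h2, mul_assoc, Complex.re_ofReal_mul]

theorem hasSum_opL_self {m : ℝ → ℝ} {M P : ℝ} (hP : 1 ≤ P) (hm : ∀ ξ, |m ξ| ≤ M)
    (heven : ∀ ξ, m (-ξ) = m ξ) {u : ℝ → ℝ} (hu : MemHP P 1 u) :
    HasSum (fun k => m (freq P k) * ‖fourierCoeffP P u k‖ ^ 2)
      (∫ x in (-(P / 2))..(P / 2), u x * opL m P u x) := by
  refine hasSum_of_eq (hasSum_mul_opL hP hm heven hu hu.1) (fun k => ?_) ?_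
  · rw [Complex.mul_conj, Complex.ofReal_re, Complex.normSq_eq_norm_sq]
  · simp only [mul_comm]

theorem energy_eq {m n : ℝ → ℝ} {M P : ℝ} (hP : 1 ≤ P) (hm : ∀ ξ, |m ξ| ≤ M)
    (heven : ∀ ξ, m (-ξ) = m ξ) {u : ℝ → ℝ} (hu : MemHP P 1 u) :
    energy m n P u = -(1 / 2 * ∑' k, m (freq P k) * ‖fourierCoeffP P u k‖ ^ 2) -
      ∫ x, primitive n (u x) ∂(periodMeasure P) := by
  rw [energy, (hasSum_opL_self hP hm heven hu).tsum_eq, ← intervalIntegral_eq_period (by linarith)]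

/-! ### Compositions with small Lipschitz functions -/

theorem hasDerivAt_wave (P : ℝ) (k : ℤ) :
    HasDerivAt (wave P k) ((freq P k : ℂ) * Complex.I) 0 := by
  have h1 : HasDerivAt (fun z : ℂ => Complex.exp ((freq P k : ℂ) * Complex.I * z))
      (Complex.exp ((freq P k : ℂ) * Complex.I * (0 : ℝ)) * ((freq P k : ℂ) * Complex.I * 1))
      ((0 : ℝ) : ℂ) :=
    ((hasDerivAt_id _).const_mul _).cexp
  have h2 := h1.comp_ofReal
  simp only [Complex.ofReal_zero, mul_zero, Complex.exp_zero, one_mul, mul_one] at h2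
  refine h2.congr_of_eventuallyEq (Eventually.of_forall fun x => ?_)
  simp only [wave, freq]
  congr 1; push_cast; ring

/-- Parseval for finite differences, which replace weak derivatives: a composition $n(u)$ is easy to
control through its increments. -/
theorem hasSum_difference {P : ℝ} (hP : 0 < P) {u : ℝ → ℝ} (hc : Continuous u)
    (hper : Function.Periodic u P) (h : ℝ) :
    HasSum (fun k => ‖wave P k h - 1‖ ^ 2 * ‖fourierCoeffP P u k‖ ^ 2)
      (∫ x in (-(P / 2))..(P / 2), (u (x + h) - u x) ^ 2) := by
  have h0 := memL2P_of_continuous hc hper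
  have h1 : MemL2P P fun x => u (x + h) :=
    memL2P_of_continuous (by fun_prop) fun x => by
      rw [show x + P + h = x + h + P by ring, hper]
  refine hasSum_of_eq ((h1.add (h0.const_smul (-1))).hasSum_sq hP) (fun k => ?_) ?_
  · rw [fourierCoeffP_add hP h1 (h0.const_smul _), fourierCoeffP_const_smul,
      fourierCoeffP_translate hP hper, ← mul_pow, ← norm_mul]
    congr 2; push_cast; ring
  · simp [sub_eq_add_neg]

/-- The derivative of `g` is bounded in `L²` by `ε` times the derivative of `u` if the
increments of `g` are bounded by `ε` times the increments of `u`. -/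
theorem tsum_freq_sq_le_of_increments {P ε : ℝ} (hP : 0 < P) {u g : ℝ → ℝ}
    (huc : Continuous u) (hgc : Continuous g) (hu : Function.Periodic u P)
    (hg : Function.Periodic g P) (hinc : ∀ x y, |g x - g y| ≤ ε * |u x - u y|)
    (hs : Summable fun k => freq P k ^ 2 * ‖fourierCoeffP P u k‖ ^ 2) :
    Summable (fun k => freq P k ^ 2 * ‖fourierCoeffP P g k‖ ^ 2) ∧
      ∑' k, freq P k ^ 2 * ‖fourierCoeffP P g k‖ ^ 2 ≤
        ε ^ 2 * ∑' k, freq P k ^ 2 * ‖fourierCoeffP P u k‖ ^ 2 := by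
  have hdiff : ∀ h : ℝ, ∑' k, ‖wave P k h - 1‖ ^ 2 * ‖fourierCoeffP P u k‖ ^ 2 ≤
      h ^ 2 * ∑' k, freq P k ^ 2 * ‖fourierCoeffP P u k‖ ^ 2 := by
    intro h
    rw [← tsum_mul_left]
    refine (hasSum_difference hP huc hu h).summable.tsum_le_tsum (fun k => ?_) (hs.mul_left _)
    rw [← mul_assoc]
    gcongr
    rw [← mul_pow]
    have h1 : ‖wave P k h - 1‖ ≤ |h * freq P k| := by
      have := Real.norm_exp_I_mul_ofReal_sub_one_le (x := h * freq P k)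
      rw [Real.norm_eq_abs] at this
      convert this using 4
      unfold wave freq; push_cast; congr 1; ring
    rw [← sq_abs (h * freq P k)]
    gcongr
  have hint : ∀ h : ℝ, ∫ x in (-(P / 2))..(P / 2), (g (x + h) - g x) ^ 2 ≤
      ε ^ 2 * ∫ x in (-(P / 2))..(P / 2), (u (x + h) - u x) ^ 2 := by
    intro h
    rw [← intervalIntegral.integral_const_mul]
    refine intervalIntegral.integral_mono_on (by linarith)
      (Continuous.intervalIntegrable (by fun_prop) _ _)
      (Continuous.intervalIntegrable (by fun_prop) _ _) fun x _ => ?_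
    rw [← mul_pow, ← sq_abs (g _ - g _)]
    have h1 := hinc (x + h) x
    calc |g (x + h) - g x| ^ 2 ≤ (ε * |u (x + h) - u x|) ^ 2 := by gcongr
      _ = _ := by rw [mul_pow, mul_pow, sq_abs]
  have key : ∀ s : Finset ℤ, ∑ k ∈ s, freq P k ^ 2 * ‖fourierCoeffP P g k‖ ^ 2 ≤
      ε ^ 2 * ∑' k, freq P k ^ 2 * ‖fourierCoeffP P u k‖ ^ 2 := by
    intro s
    -- Over finitely many modes the squared difference quotients of the exponentials are bounded
    -- uniformly in $h$. As $h\to0$ these quotients tend to $i\xi$, giving the bound on the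
    -- derivative.
    have hfin : ∀ h : ℝ, h ≠ 0 →
        ∑ k ∈ s, ‖h⁻¹ • (wave P k (0 + h) - wave P k 0)‖ ^ 2 * ‖fourierCoeffP P g k‖ ^ 2 ≤
        ε ^ 2 * ∑' k, freq P k ^ 2 * ‖fourierCoeffP P u k‖ ^ 2 := by
      intro h hh
      have h1 := hasSum_difference hP hgc hg h
      have h2 := h1.summable.sum_le_tsum s fun k _ => by positivity
      rw [h1.tsum_eq] at h2
      have h3 := (hasSum_difference hP huc hu h).tsum_eq
      have h4 := hint h
      rw [← h3] at h4
      have h5 := hdiff h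
      have h6 : ∑ k ∈ s, ‖wave P k h - 1‖ ^ 2 * ‖fourierCoeffP P g k‖ ^ 2 ≤
          h ^ 2 * (ε ^ 2 * ∑' k, freq P k ^ 2 * ‖fourierCoeffP P u k‖ ^ 2) := by
        calc _ ≤ ε ^ 2 * (h ^ 2 * ∑' k, freq P k ^ 2 * ‖fourierCoeffP P u k‖ ^ 2) :=
              h2.trans (h4.trans (by gcongr))
          _ = _ := by ring
      have h7 : ∀ k, wave P k 0 = 1 := fun k => by simp [wave]
      simp only [zero_add, h7, norm_smul, mul_pow, mul_assoc, norm_inv, Real.norm_eq_abs, inv_pow,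
        sq_abs]
      rw [← Finset.mul_sum, inv_mul_le_iff₀ (by positivity)]
      exact h6
    have hlim : Tendsto (fun h : ℝ => ∑ k ∈ s, ‖h⁻¹ • (wave P k (0 + h) - wave P k 0)‖ ^ 2 *
        ‖fourierCoeffP P g k‖ ^ 2) (𝓝[≠] 0)
        (𝓝 (∑ k ∈ s, ‖(freq P k : ℂ) * Complex.I‖ ^ 2 * ‖fourierCoeffP P g k‖ ^ 2)) :=
      tendsto_finsetSum _ fun k _ =>
        (((hasDerivAt_wave P k).tendsto_slope_zero.norm).pow 2).mul_const _
    have h8 := le_of_tendsto hlim (eventually_nhdsWithin_of_forall hfin)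
    simpa only [norm_mul, Complex.norm_I, mul_one, Complex.norm_real, Real.norm_eq_abs, sq_abs]
      using h8
  exact ⟨summable_of_sum_le (fun k => by positivity) key,
    Real.tsum_le_of_sum_le (fun k => by positivity) key⟩

/-! ### The primitive of the nonlinearity -/

theorem continuous_primitive {n : ℝ → ℝ} (hn : Continuous n) : Continuous (primitive n) :=
  intervalIntegral.continuous_primitive (fun _ _ => hn.intervalIntegrable _ _) 0

theorem abs_le_of_lipschitz {n : ℝ → ℝ} {ε r : ℝ} (h0 : n 0 = 0)
    (hlip : ∀ x y, |x| ≤ r → |y| ≤ r → |n x - n y| ≤ ε * |x - y|) {x : ℝ} (hx : |x| ≤ r) :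
    |n x| ≤ ε * |x| := by
  have := hlip x 0 hx (by simpa using (abs_nonneg x).trans hx)
  simpa [h0] using this

theorem abs_le_of_mem_uIcc {r x y s : ℝ} (hx : |x| ≤ r) (hy : |y| ≤ r) (hs : s ∈ uIcc x y) :
    |s| ≤ r := by
  rw [abs_le] at hx hy ⊢
  obtain ⟨h1, h2⟩ := hs
  exact ⟨(le_min hx.1 hy.1).trans h1, h2.trans (max_le hx.2 hy.2)⟩

/-- The remainder is $\int_x^y(n(s)-n(x))\,ds$, and the Lipschitz bound applies because the segment
stays in $[-r,r]$. -/
theorem abs_primitive_taylor_le {n : ℝ → ℝ} {ε r : ℝ} (hε : 0 ≤ ε) (hn : Continuous n)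
    (hlip : ∀ x y, |x| ≤ r → |y| ≤ r → |n x - n y| ≤ ε * |x - y|) {x y : ℝ} (hx : |x| ≤ r)
    (hy : |y| ≤ r) :
    |primitive n y - primitive n x - n x * (y - x)| ≤ ε * (y - x) ^ 2 := by
  have e : primitive n y - primitive n x - n x * (y - x) = ∫ s in x..y, (n s - n x) := by
    rw [intervalIntegral.integral_sub (hn.intervalIntegrable _ _) (by simp),
      primitive, primitive, intervalIntegral.integral_interval_sub_left
        (hn.intervalIntegrable _ _) (hn.intervalIntegrable _ _)]
    simp; ring
  rw [e, ← sq_abs (y - x), sq, ← mul_assoc, ← Real.norm_eq_abs]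
  refine intervalIntegral.norm_integral_le_of_norm_le_const fun s hs => ?_
  have hs' := uIoc_subset_uIcc hs
  exact (hlip s x (abs_le_of_mem_uIcc hx hy hs') hx).trans
    (mul_le_mul_of_nonneg_left (abs_sub_left_of_mem_uIcc hs') hε)

theorem abs_primitive_le {n : ℝ → ℝ} {ε r : ℝ} (hε : 0 ≤ ε) (hn : Continuous n) (h0 : n 0 = 0)
    (hlip : ∀ x y, |x| ≤ r → |y| ≤ r → |n x - n y| ≤ ε * |x - y|) {x : ℝ} (hx : |x| ≤ r) :
    |primitive n x| ≤ ε * x ^ 2 := by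
  have := abs_primitive_taylor_le hε hn hlip (x := 0) (y := x)
    (by simpa using (abs_nonneg x).trans hx) hx
  simpa [primitive, h0] using this

theorem abs_primitive_sub_le {n : ℝ → ℝ} {ε r : ℝ} (hε : 0 ≤ ε) (hn : Continuous n)
    (h0 : n 0 = 0) (hlip : ∀ x y, |x| ≤ r → |y| ≤ r → |n x - n y| ≤ ε * |x - y|) {x y : ℝ}
    (hx : |x| ≤ r) (hy : |y| ≤ r) : |primitive n y - primitive n x| ≤ ε * r * |y - x| := by
  rw [primitive, primitive, intervalIntegral.integral_interval_sub_left
    (hn.intervalIntegrable _ _) (hn.intervalIntegrable _ _), ← Real.norm_eq_abs]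
  refine intervalIntegral.norm_integral_le_of_norm_le_const fun s hs => ?_
  have hs' := abs_le_of_mem_uIcc hx hy (uIoc_subset_uIcc hs)
  refine (abs_le_of_lipschitz h0 hlip hs').trans ?_
  gcongr

theorem integrable_primitive_comp {P : ℝ} {n : ℝ → ℝ} {ε r : ℝ} (hε : 0 ≤ ε)
    (hn : Continuous n) (h0 : n 0 = 0)
    (hlip : ∀ x y, |x| ≤ r → |y| ≤ r → |n x - n y| ≤ ε * |x - y|) {u : ℝ → ℝ}
    (hu : MemL2P P u) (hb : ∀ᵐ x ∂(periodMeasure P), |u x| ≤ r) :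
    Integrable (fun x => primitive n (u x)) (periodMeasure P) := by
  refine (hu.integrable_sq.const_mul ε).mono'
    ((continuous_primitive hn).comp_aestronglyMeasurable hu.2.1) ?_
  filter_upwards [hb] with x hx
  exact abs_primitive_le hε hn h0 hlip hx

theorem abs_integral_primitive_le {P : ℝ} {n : ℝ → ℝ} {ε r : ℝ} (hε : 0 ≤ ε)
    (hn : Continuous n) (h0 : n 0 = 0)
    (hlip : ∀ x y, |x| ≤ r → |y| ≤ r → |n x - n y| ≤ ε * |x - y|) {u : ℝ → ℝ}
    (hu : MemL2P P u) (hb : ∀ᵐ x ∂(periodMeasure P), |u x| ≤ r) :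
    |∫ x, primitive n (u x) ∂(periodMeasure P)| ≤ ε * ∫ x, u x ^ 2 ∂(periodMeasure P) := by
  rw [← integral_const_mul, ← Real.norm_eq_abs]
  refine norm_integral_le_of_norm_le (hu.integrable_sq.const_mul ε) ?_
  filter_upwards [hb] with x hx
  exact abs_primitive_le hε hn h0 hlip hx

/-! ### Derivatives of the functionals -/

theorem MemHP.integral_sq_le {P : ℝ} (hP : 0 < P) {v : ℝ → ℝ} (hv : MemHP P 1 v) :
    ∫ x, v x ^ 2 ∂(periodMeasure P) ≤ normHP P 1 v ^ 2 := by
  rw [← intervalIntegral_eq_period hP, ← (hv.1.hasSum_sq hP).tsum_eq]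
  exact hv.tsum_sq_le

/-- A second-order Taylor estimate implies differentiability. -/
theorem hasL2Derivative_of_quadratic {P : ℝ} {F : (ℝ → ℝ) → ℝ} {u g : ℝ → ℝ} {K η : ℝ}
    (hg : MemL2P P g) (hη : 0 < η)
    (h : ∀ v, MemHP P 1 v → normHP P 1 v ≤ η →
      |F (u + v) - F u - ∫ x in (-(P / 2))..(P / 2), g x * v x| ≤ K * normHP P 1 v ^ 2) :
    HasL2Derivative P F u g := by
  refine ⟨hg, fun ε hε => ⟨min η (ε / (|K| + 1)), by positivity, fun v hv hn => ?_⟩⟩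
  have h1 := hn.trans_le (min_le_left _ _)
  have h2 := hn.trans_le (min_le_right _ _)
  refine (h v hv h1.le).trans ?_
  have hn0 := normHP_nonneg P v
  rw [lt_div_iff₀ (by positivity)] at h2
  rw [sq, ← mul_assoc]
  gcongr
  nlinarith [le_abs_self K]

theorem momentum_add {P : ℝ} (hP : 0 < P) {u v : ℝ → ℝ} (hu : MemL2P P u) (hv : MemL2P P v) :
    momentum P (u + v) =
      momentum P u + (∫ x in (-(P / 2))..(P / 2), u x * v x) + momentum P v := by
  simp only [momentum, intervalIntegral_eq_period hP]
  have h1 := hu.integrable_sq.const_mul (1 / 2)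
  have h2 := hu.integrable_mul hv
  have h3 := hv.integrable_sq.const_mul (1 / 2)
  have h12 : Integrable (fun x => 1 / 2 * u x ^ 2 + u x * v x) (periodMeasure P) := h1.add h2
  rw [← integral_const_mul, ← integral_const_mul, ← integral_const_mul, ← integral_add h1 h2,
    ← integral_add h12 h3]
  congr 1; ext x; simp; ring

theorem momentum_const_smul (P s : ℝ) (u : ℝ → ℝ) :
    momentum P (s • u) = s ^ 2 * momentum P u := by
  simp only [momentum, Pi.smul_apply, smul_eq_mul, mul_pow]
  rw [intervalIntegral.integral_const_mul]
  ring

theorem momentum_nonneg {P : ℝ} (hP : 0 < P) (u : ℝ → ℝ) : 0 ≤ momentum P u := by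
  rw [momentum, intervalIntegral_eq_period hP]
  exact mul_nonneg (by norm_num) (integral_nonneg fun _ => sq_nonneg _)

theorem momentum_expansion {P : ℝ} (hP : 0 < P) {u v : ℝ → ℝ} (hu : MemL2P P u)
    (hv : MemHP P 1 v) :
    |momentum P (u + v) - momentum P u - ∫ x in (-(P / 2))..(P / 2), u x * v x| ≤
      1 / 2 * normHP P 1 v ^ 2 := by
  rw [momentum_add hP hu hv.1, add_assoc, add_sub_cancel_left, add_sub_cancel_left,
    abs_of_nonneg (momentum_nonneg hP v), momentum_eq hP hv.1]
  gcongr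
  exact hv.tsum_sq_le

theorem hasL2Derivative_momentum {P : ℝ} (hP : 0 < P) {u : ℝ → ℝ} (hu : MemL2P P u) :
    HasL2Derivative P (momentum P) u u :=
  hasL2Derivative_of_quadratic hu one_pos fun _ hv _ => momentum_expansion hP hu hv

theorem memL2P_comp {P : ℝ} {n u : ℝ → ℝ} (hn : Continuous n) (hu : Continuous u)
    (hper : Function.Periodic u P) : MemL2P P fun x => n (u x) :=
  memL2P_of_continuous (hn.comp hu) fun x => by rw [hper x]

/-- The `L²`-gradient of the energy. -/
noncomputable def energyGrad (m n : ℝ → ℝ) (P : ℝ) (u : ℝ → ℝ) (x : ℝ) : ℝ :=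
  -opL m P u x - n (u x)

theorem memL2P_energyGrad {m n : ℝ → ℝ} {M P : ℝ} (hP : 1 ≤ P) (hm : ∀ ξ, |m ξ| ≤ M)
    (heven : ∀ ξ, m (-ξ) = m ξ) (hn : Continuous n) {u : ℝ → ℝ} (hu : MemHP P 1 u)
    (huc : Continuous u) : MemL2P P (energyGrad m n P u) ∧ Continuous (energyGrad m n P u) := by
  obtain ⟨h1, h2, -⟩ := memHP_opL hP hm heven hu
  have hc : Continuous (energyGrad m n P u) := by
    unfold energyGrad
    fun_prop
  exact ⟨memL2P_of_continuous hc fun x => by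
    simp only [energyGrad, h1.1.1 x, hu.1.1 x], hc⟩

theorem integral_energyGrad_mul {m n : ℝ → ℝ} {M P : ℝ} (hP : 1 ≤ P) (hm : ∀ ξ, |m ξ| ≤ M)
    (heven : ∀ ξ, m (-ξ) = m ξ) (hn : Continuous n) {u v : ℝ → ℝ} (hu : MemHP P 1 u)
    (huc : Continuous u) (hv : MemL2P P v) :
    ∫ x in (-(P / 2))..(P / 2), energyGrad m n P u x * v x =
      -∑' k, m (freq P k) * (fourierCoeffP P u k * (starRingEnd ℂ) (fourierCoeffP P v k)).re
        - ∫ x, n (u x) * v x ∂(periodMeasure P) := by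
  have hP0 : 0 < P := by linarith
  obtain ⟨h1, -, -⟩ := memHP_opL hP hm heven hu
  rw [(hasSum_mul_opL hP hm heven hu hv).tsum_eq]
  simp only [intervalIntegral_eq_period hP0]
  have h2 : Integrable (fun x => -(opL m P u x * v x)) (periodMeasure P) :=
    (h1.1.integrable_mul hv).neg
  rw [← integral_neg, ← integral_sub h2 ((memL2P_comp hn huc hu.1.1).integrable_mul hv)]
  congr 1; ext x; simp only [energyGrad]; ring

/-- The multiplier part is exactly quadratic; the rest is the pointwise Taylor bound integrated. The
radii fit since the embedding constant is 2: norm $r/4$ gives $|v|\le r/2$ almost everywhere, hence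
$|u+v|\le r$. -/
theorem energy_expansion {m n : ℝ → ℝ} {M P ε r : ℝ} (hP : 1 ≤ P) (hm : ∀ ξ, |m ξ| ≤ M)
    (heven : ∀ ξ, m (-ξ) = m ξ) (hε : 0 ≤ ε) (hn : Continuous n) (h0 : n 0 = 0)
    (hlip : ∀ x y, |x| ≤ r → |y| ≤ r → |n x - n y| ≤ ε * |x - y|) {u v : ℝ → ℝ}
    (hu : MemHP P 1 u) (huc : Continuous u) (hub : ∀ x, |u x| ≤ r / 2) (hv : MemHP P 1 v)
    (hvr : normHP P 1 v ≤ r / 4) :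
    |energy m n P (u + v) - energy m n P u -
      ∫ x in (-(P / 2))..(P / 2), energyGrad m n P u x * v x| ≤
      (M / 2 + ε) * normHP P 1 v ^ 2 := by
  have hP0 : 0 < P := by linarith
  have hvb : ∀ᵐ x ∂(periodMeasure P), |v x| ≤ r / 2 := by
    filter_upwards [hv.ae_abs_le_normHP hP] with x hx
    linarith
  have hub' : ∀ᵐ x ∂(periodMeasure P), |u x| ≤ r :=
    Eventually.of_forall fun x => by have := hub x; have := abs_nonneg (u x); linarith
  have huvb : ∀ᵐ x ∂(periodMeasure P), |(u + v) x| ≤ r := by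
    filter_upwards [hvb] with x hx
    exact (abs_add_le _ _).trans (by linarith [hub x])
  have huv := hu.add hP0 hv
  have hM : 0 ≤ M := (abs_nonneg _).trans (hm 0)
  have s1 := (hasSum_opL_self hP hm heven hu).summable
  have s2 := (hasSum_opL_self hP hm heven hv).summable
  have s3 := (hasSum_mul_opL hP hm heven hu hv.1).summable
  have hquad : ∑' k, m (freq P k) * ‖fourierCoeffP P (u + v) k‖ ^ 2 =
      ∑' k, m (freq P k) * ‖fourierCoeffP P u k‖ ^ 2 +
      2 * ∑' k, m (freq P k) * (fourierCoeffP P u k * (starRingEnd ℂ) (fourierCoeffP P v k)).re +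
      ∑' k, m (freq P k) * ‖fourierCoeffP P v k‖ ^ 2 := by
    rw [← tsum_mul_left, ← s1.tsum_add (s3.mul_left 2), ← (s1.add (s3.mul_left 2)).tsum_add s2]
    congr 1; ext k
    rw [fourierCoeffP_add hP0 hu.1 hv.1, ← Complex.normSq_eq_norm_sq, Complex.normSq_add,
      Complex.normSq_eq_norm_sq, Complex.normSq_eq_norm_sq]
    ring
  have hbil : |∑' k, m (freq P k) * ‖fourierCoeffP P v k‖ ^ 2| ≤ M * normHP P 1 v ^ 2 := by
    have h1 := (hv.1.hasSum_sq hP0).summable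
    have h2 := tsum_of_norm_bounded (f := fun k => m (freq P k) * ‖fourierCoeffP P v k‖ ^ 2)
      (h1.mul_left M).hasSum fun k => by
        rw [norm_mul, Real.norm_eq_abs, norm_pow, norm_norm]
        gcongr
        exact hm _
    rw [tsum_mul_left] at h2
    refine h2.trans ?_
    gcongr
    exact hv.tsum_sq_le
  have i1 := integrable_primitive_comp hε hn h0 hlip huv.1 huvb
  have i2 := integrable_primitive_comp hε hn h0 hlip hu.1 hub'
  have i3 := (memL2P_comp hn huc hu.1.1).integrable_mul hv.1
  have hN : |∫ x, primitive n ((u + v) x) ∂(periodMeasure P) -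
      ∫ x, primitive n (u x) ∂(periodMeasure P) - ∫ x, n (u x) * v x ∂(periodMeasure P)| ≤
      ε * normHP P 1 v ^ 2 := by
    have i12 : Integrable (fun x => primitive n ((u + v) x) - primitive n (u x))
      (periodMeasure P) := i1.sub i2
    rw [← integral_sub i1 i2, ← integral_sub i12 i3]
    refine le_trans ?_ (mul_le_mul_of_nonneg_left (hv.integral_sq_le hP0) hε)
    rw [← integral_const_mul, ← Real.norm_eq_abs]
    refine norm_integral_le_of_norm_le (hv.1.integrable_sq.const_mul ε) ?_
    filter_upwards [huvb, hub'] with x hx hx2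
    have := abs_primitive_taylor_le hε hn hlip hx2 hx
    simpa using this
  rw [energy_eq hP hm heven huv, energy_eq hP hm heven hu,
    integral_energyGrad_mul hP hm heven hn hu huc hv.1, hquad]
  rw [abs_le] at hbil hN ⊢
  constructor <;> nlinarith [hbil.1, hbil.2, hN.1, hN.2]

/-! ### Admissible variations -/

/-- The bilinear form of the periodic Sobolev space of order one. -/
noncomputable def innerHP (P : ℝ) (u v : ℝ → ℝ) : ℝ :=
  ∑' k, (1 + freq P k ^ 2) * (fourierCoeffP P u k * (starRingEnd ℂ) (fourierCoeffP P v k)).re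

theorem abs_re_mul_conj_le (z w : ℂ) :
    |(z * (starRingEnd ℂ) w).re| ≤ ‖z‖ ^ 2 + ‖w‖ ^ 2 := by
  refine (Complex.abs_re_le_norm _).trans ?_
  rw [norm_mul, Complex.norm_conj]
  nlinarith [sq_nonneg (‖z‖ - ‖w‖), norm_nonneg z, norm_nonneg w]

theorem MemHP.summable_inner {P : ℝ} {u v : ℝ → ℝ} (hu : MemHP P 1 u) (hv : MemHP P 1 v) :
    Summable fun k => (1 + freq P k ^ 2) *
      (fourierCoeffP P u k * (starRingEnd ℂ) (fourierCoeffP P v k)).re := by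
  refine Summable.of_norm_bounded (hu.weighted.add hv.weighted) fun k => ?_
  have h : 0 ≤ 1 + freq P k ^ 2 := by positivity
  rw [Real.norm_eq_abs, abs_mul, abs_of_nonneg h, ← mul_add]
  gcongr
  exact abs_re_mul_conj_le _ _

theorem normHP_add_sq {P : ℝ} (hP : 0 < P) {u v : ℝ → ℝ} (hu : MemHP P 1 u) (hv : MemHP P 1 v) :
    normHP P 1 (u + v) ^ 2 = normHP P 1 u ^ 2 + 2 * innerHP P u v + normHP P 1 v ^ 2 := by
  have hi := hu.summable_inner hv
  rw [normHP_sq, normHP_sq, normHP_sq, innerHP, ← tsum_mul_left,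
    ← hu.weighted.tsum_add (hi.mul_left 2),
    ← (hu.weighted.add (hi.mul_left 2)).tsum_add hv.weighted]
  congr 1; ext k
  rw [fourierCoeffP_add hP hu.1 hv.1, ← Complex.normSq_eq_norm_sq, Complex.normSq_add,
      Complex.normSq_eq_norm_sq, Complex.normSq_eq_norm_sq]
  ring

theorem innerHP_const_smul_right (P t : ℝ) (u v : ℝ → ℝ) :
    innerHP P u (t • v) = t * innerHP P u v := by
  unfold innerHP
  rw [← tsum_mul_left]
  congr 1; ext k
  rw [fourierCoeffP_const_smul, map_mul, Complex.conj_ofReal, mul_left_comm,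
    Complex.re_ofReal_mul]
  ring

theorem normHP_add_sq_le {P : ℝ} (hP : 0 < P) {u v : ℝ → ℝ} (hu : MemHP P 1 u)
    (hv : MemHP P 1 v) :
    normHP P 1 (u + v) ^ 2 ≤ 2 * (normHP P 1 u ^ 2 + normHP P 1 v ^ 2) := by
  have h1 := normHP_add_sq hP hu hv
  have h2 := normHP_add_sq hP hu (hv.const_smul (-1))
  rw [innerHP_const_smul_right, normHP_const_smul] at h2
  have h3 := sq_nonneg (normHP P 1 (u + (-1 : ℝ) • v))
  simp only [abs_neg, abs_one, one_mul] at h2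
  linarith

/-- Take $s=(1+x)^{-1/2}$. With $x=t^2b$ it rescales $u+tv$ back to momentum $\mu$ when $v\perp u$,
and the bound $1-x\le s^2\le s$ says the rescaling costs only order $t^2$. -/
theorem exists_normalising_factor {x : ℝ} (hx : 0 ≤ x) :
    ∃ s : ℝ, 0 < s ∧ s ≤ 1 ∧ 1 - x ≤ s ∧ s ^ 2 * (1 + x) = 1 := by
  have hpos : 0 < 1 + x := by positivity
  have hsq : (1 / √(1 + x)) ^ 2 = 1 / (1 + x) := by rw [one_div_pow, Real.sq_sqrt hpos.le]
  have h0 : 0 < 1 / √(1 + x) := by positivity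
  have h1 : 1 / √(1 + x) ≤ 1 := by
    rw [div_le_one (by positivity)]
    exact Real.one_le_sqrt.2 (by linarith)
  refine ⟨1 / √(1 + x), h0, h1, ?_, by rw [hsq]; field_simp⟩
  have h5 : 1 - x ≤ (1 / √(1 + x)) ^ 2 := by
    rw [hsq, le_div_iff₀ hpos]; nlinarith [sq_nonneg x]
  nlinarith

/-- Division by $t$ leaves $s\,\ell_v$ plus an error of order $t$; the factor 2 comes from
$s\ge1/2$. -/
theorem lower_bound_of_first_order {s t b K D lu lv : ℝ} (hb : 0 ≤ b) (ht : 0 < t)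
    (hs0 : 0 < s) (hs1 : s ≤ 1) (hs : 1 - t ^ 2 * b ≤ s) (htb : t ^ 2 * b ≤ 1 / 2) (hD : 0 ≤ D)
    (h : 0 ≤ s * t * lv + (s - 1) * lu + |K| * (t ^ 2 * D)) :
    -(2 * (b * |lu| + |K| * D)) * t ≤ lv := by
  have h8 : (s - 1) * lu ≤ t ^ 2 * b * |lu| := by
    have h1 : (1 - s) * (-lu) ≤ (1 - s) * |lu| :=
      mul_le_mul_of_nonneg_left (neg_le_abs lu) (by linarith)
    have h2 : (1 - s) * |lu| ≤ t ^ 2 * b * |lu| := by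
      gcongr; linarith
    linarith
  have h9 : 0 ≤ t * (s * lv + (b * |lu| + |K| * D) * t) := by
    calc 0 ≤ s * t * lv + t ^ 2 * b * |lu| + |K| * (t ^ 2 * D) := by linarith
      _ = _ := by ring
  have h10 := nonneg_of_mul_nonneg_right h9 ht
  by_contra! hneg
  have hE : 0 ≤ (b * |lu| + |K| * D) * t := by positivity
  nlinarith

/-- First-order necessary condition at a minimiser on the intersection of a closed ball with a
level set of the momentum. -/
theorem variational_inequality {P R μ K η : ℝ} (hP : 0 < P) (hμ : 0 < μ) (hη : 0 < η)
    {F : (ℝ → ℝ) → ℝ} {u g v : ℝ → ℝ} (hg : MemL2P P g) (hu : MemHP P 1 u)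
    (huR : normHP P 1 u ≤ R) (huμ : momentum P u = μ)
    (hmin : ∀ w, MemHP P 1 w → normHP P 1 w ≤ R → momentum P w = μ → F u ≤ F w)
    (hF : ∀ w, MemHP P 1 w → normHP P 1 w ≤ η →
      |F (u + w) - F u - ∫ x in (-(P / 2))..(P / 2), g x * w x| ≤ K * normHP P 1 w ^ 2)
    (hv : MemHP P 1 v) (horth : ∫ x in (-(P / 2))..(P / 2), u x * v x = 0)
    (hdir : normHP P 1 u < R ∨ innerHP P u v < 0) :
    0 ≤ ∫ x in (-(P / 2))..(P / 2), g x * v x := by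
  set b := momentum P v / μ with hb
  have hb0 : 0 ≤ b := div_nonneg (momentum_nonneg hP v) hμ.le
  set A := normHP P 1 u
  set B := normHP P 1 v
  have hA : 0 ≤ A := normHP_nonneg _ _
  have hR : 0 ≤ R := hA.trans huR
  set ℓv := ∫ x in (-(P / 2))..(P / 2), g x * v x with hℓv
  set ℓu := ∫ x in (-(P / 2))..(P / 2), g x * u x with hℓu
  set D := 2 * (B ^ 2 + b ^ 2 * A ^ 2) with hD
  have hD0 : 0 ≤ D := by positivity
  -- the admissible curve
  have key : ∀ᶠ t : ℝ in 𝓝[>] 0, -(2 * (b * |ℓu| + |K| * D)) * t ≤ ℓv := by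
    -- The point $u+tv$ stays in the ball: by room to spare if $u$ is interior, otherwise because
    -- the negative linear term beats the quadratic one. Rescaling by $s\le1$ then keeps it there.
    have e1 : ∀ᶠ t : ℝ in 𝓝[>] 0, A ^ 2 + 2 * (t * innerHP P u v) + t ^ 2 * B ^ 2 ≤ R ^ 2 := by
      rcases hdir with h | h
      · have hc : Tendsto (fun t : ℝ => A ^ 2 + 2 * (t * innerHP P u v) + t ^ 2 * B ^ 2) (𝓝[>] 0)
            (𝓝 (A ^ 2 + 2 * (0 * innerHP P u v) + 0 ^ 2 * B ^ 2)) :=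
          (Continuous.tendsto (by fun_prop) 0).mono_left nhdsWithin_le_nhds
        have hlt : A ^ 2 + 2 * (0 * innerHP P u v) + 0 ^ 2 * B ^ 2 < R ^ 2 := by
          have : A ^ 2 < R ^ 2 := by gcongr
          linarith
        filter_upwards [hc.eventually (eventually_lt_nhds hlt)] with t ht using ht.le
      · have hc : Tendsto (fun t : ℝ => 2 * innerHP P u v + t * B ^ 2) (𝓝[>] 0)
            (𝓝 (2 * innerHP P u v + 0 * B ^ 2)) :=
          (Continuous.tendsto (by fun_prop) 0).mono_left nhdsWithin_le_nhds
        have hlt : 2 * innerHP P u v + 0 * B ^ 2 < 0 := by linarith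
        filter_upwards [hc.eventually (eventually_lt_nhds hlt), self_mem_nhdsWithin] with t ht ht0
        have h1 : A ^ 2 ≤ R ^ 2 := by gcongr
        have h2 : 0 < t := ht0
        nlinarith
    have e2 : ∀ᶠ t : ℝ in 𝓝[>] 0, t ^ 2 * b ≤ 1 / 2 := by
      have hc : Tendsto (fun t : ℝ => t ^ 2 * b) (𝓝[>] 0) (𝓝 (0 ^ 2 * b)) :=
        (Continuous.tendsto (by fun_prop) 0).mono_left nhdsWithin_le_nhds
      filter_upwards [hc.eventually (eventually_lt_nhds (b := 1 / 2) (by norm_num))] with t ht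
        using ht.le
    have e3 : ∀ᶠ t : ℝ in 𝓝[>] 0, t ^ 2 * D ≤ η ^ 2 := by
      have hc : Tendsto (fun t : ℝ => t ^ 2 * D) (𝓝[>] 0) (𝓝 (0 ^ 2 * D)) :=
        (Continuous.tendsto (by fun_prop) 0).mono_left nhdsWithin_le_nhds
      filter_upwards [hc.eventually (eventually_lt_nhds (b := η ^ 2) (by simp; positivity))]
        with t ht using ht.le
    have e4 : ∀ᶠ t : ℝ in 𝓝[>] 0, t ≤ 1 :=
      (eventually_le_nhds one_pos).filter_mono nhdsWithin_le_nhds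
    filter_upwards [e1, e2, e3, e4, self_mem_nhdsWithin] with t h1 h2 h3 h4 ht
    have ht : 0 < t := ht
    obtain ⟨s, hs0, hs1, hs3, hsq⟩ := exists_normalising_factor (mul_nonneg (sq_nonneg t) hb0)
    have htv := hv.const_smul t
    have hutv := hu.add hP htv
    set w := (s * t) • v + (s - 1) • u with hw
    have hwH : MemHP P 1 w := (hv.const_smul _).add hP (hu.const_smul _)
    have hcurve : u + w = s • (u + t • v) := by
      ext x; simp [hw]; ring
    have hmom : momentum P (u + w) = μ := by
      rw [hcurve]
      have h6 : ∫ x in (-(P / 2))..(P / 2), u x * (t • v) x = 0 := by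
        simp only [Pi.smul_apply, smul_eq_mul, mul_left_comm (u _)]
        rw [intervalIntegral.integral_const_mul, horth, mul_zero]
      have h7 : momentum P v = b * μ := by rw [hb]; field_simp
      rw [momentum_const_smul, momentum_add hP hu.1 htv.1, h6, momentum_const_smul, huμ, h7]
      linear_combination μ * hsq
    have hnorm : normHP P 1 (u + w) ≤ R := by
      rw [hcurve, normHP_const_smul, abs_of_pos hs0]
      have h6 : normHP P 1 (u + t • v) ^ 2 ≤ R ^ 2 := by
        rw [normHP_add_sq hP hu htv, innerHP_const_smul_right, normHP_const_smul, mul_pow, sq_abs]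
        exact h1
      have h7 := (abs_le_of_sq_le_sq' h6 hR).2
      have h8 := normHP_nonneg P (u + t • v)
      nlinarith
    have hwD : normHP P 1 w ^ 2 ≤ t ^ 2 * D := by
      refine (normHP_add_sq_le hP (hv.const_smul _) (hu.const_smul _)).trans ?_
      rw [normHP_const_smul, normHP_const_smul, mul_pow, mul_pow, sq_abs, sq_abs]
      have h5 : (s * t) ^ 2 ≤ t ^ 2 := by
        gcongr
        exact mul_le_of_le_one_left ht.le hs1
      have h6 : (s - 1) ^ 2 ≤ t ^ 2 * b ^ 2 := by
        rw [← mul_pow, ← sq_abs (s - 1)]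
        gcongr
        rw [abs_of_nonpos (by linarith)]
        have h7 : t ^ 2 * b ≤ t * b := by
          gcongr
          exact pow_le_of_le_one ht.le h4 (by norm_num)
        linarith
      calc 2 * ((s * t) ^ 2 * B ^ 2 + (s - 1) ^ 2 * A ^ 2)
          ≤ 2 * (t ^ 2 * B ^ 2 + t ^ 2 * b ^ 2 * A ^ 2) := by gcongr
        _ = t ^ 2 * D := by rw [hD]; ring
    have h5 := hmin _ (hu.add hP hwH) hnorm hmom
    have h6 := hF w hwH (abs_le_of_sq_le_sq' (hwD.trans h3) hη.le).2
    have hlin : ∫ x in (-(P / 2))..(P / 2), g x * w x = s * t * ℓv + (s - 1) * ℓu := by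
      rw [hℓv, hℓu]
      simp only [intervalIntegral_eq_period hP]
      rw [← integral_const_mul, ← integral_const_mul,
        ← integral_add ((hg.integrable_mul hv.1).const_mul _)
          ((hg.integrable_mul hu.1).const_mul _)]
      congr 1; ext x; simp [hw]; ring
    rw [hlin] at h6
    have h7 : K * normHP P 1 w ^ 2 ≤ |K| * (t ^ 2 * D) :=
      (mul_le_mul_of_nonneg_right (le_abs_self K) (sq_nonneg _)).trans (by gcongr)
    refine lower_bound_of_first_order hb0 ht hs0 hs1 hs3 h2 hD0 ?_
    have := (abs_le.1 h6).2
    linarith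
  have hlim : Tendsto (fun t : ℝ => -(2 * (b * |ℓu| + |K| * D)) * t) (𝓝[>] 0)
      (𝓝 (-(2 * (b * |ℓu| + |K| * D)) * 0)) :=
    (Continuous.tendsto (by fun_prop) 0).mono_left nhdsWithin_le_nhds
  rw [mul_zero] at hlim
  exact le_of_tendsto hlim key

/-! ### Compactness and existence of minimisers on closed balls -/

/-- The Fourier coefficients of the elements of the closed ball of radius `R` in the periodic
Sobolev space of order one. -/
def coeffBall (P R : ℝ) : Set (ℤ → ℂ) :=
  {a | (∀ k, a (-k) = (starRingEnd ℂ) (a k)) ∧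
    ∀ s : Finset ℤ, ∑ k ∈ s, (1 + freq P k ^ 2) * ‖a k‖ ^ 2 ≤ R ^ 2}

theorem weighted_of_mem_coeffBall {P R : ℝ} {a : ℤ → ℂ} (ha : a ∈ coeffBall P R) :
    Summable (fun k => (1 + freq P k ^ 2) * ‖a k‖ ^ 2) ∧
      ∑' k, (1 + freq P k ^ 2) * ‖a k‖ ^ 2 ≤ R ^ 2 :=
  ⟨summable_of_sum_le (fun k => by positivity) ha.2,
    Real.tsum_le_of_sum_le (fun k => by positivity) ha.2⟩

theorem coeff_mem_coeffBall {P R : ℝ} {u : ℝ → ℝ} (hu : MemHP P 1 u)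
    (huR : normHP P 1 u ≤ R) : fourierCoeffP P u ∈ coeffBall P R := by
  refine ⟨fourierCoeffP_neg P u, fun s => ?_⟩
  refine (hu.weighted.sum_le_tsum s fun k _ => by positivity).trans ?_
  rw [← normHP_sq]
  have := normHP_nonneg P u
  gcongr

theorem norm_sq_le_of_mem_coeffBall {P R : ℝ} {a : ℤ → ℂ} (ha : a ∈ coeffBall P R) (k : ℤ) :
    ‖a k‖ ^ 2 ≤ R ^ 2 * (1 / (1 + 1 ^ 2 * freq P k ^ 2)) := by
  have h := ha.2 {k}
  rw [Finset.sum_singleton] at h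
  rw [mul_one_div, one_pow, one_mul, le_div_iff₀ (by positivity)]
  linarith

/-- Tychonoff's theorem in the product topology. Bounding finite partial sums, rather than the whole
series, makes the ball closed under coordinatewise convergence. -/
theorem isCompact_coeffBall {P R : ℝ} (hR : 0 ≤ R) : IsCompact (coeffBall P R) := by
  have hK : IsCompact (univ.pi fun _ : ℤ => Metric.closedBall (0 : ℂ) R) :=
    isCompact_univ_pi fun _ => isCompact_closedBall _ _
  refine hK.of_isClosed_subset ?_ fun a ha k _ => ?_
  · have h1 : IsClosed {a : ℤ → ℂ | ∀ k, a (-k) = (starRingEnd ℂ) (a k)} := by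
      simp only [ofPred_forall]
      exact isClosed_iInter fun k => isClosed_eq (continuous_apply _)
        (Complex.continuous_conj.comp (continuous_apply k))
    have h2 : IsClosed {a : ℤ → ℂ | ∀ s : Finset ℤ,
        ∑ k ∈ s, (1 + freq P k ^ 2) * ‖a k‖ ^ 2 ≤ R ^ 2} := by
      simp only [ofPred_forall]
      exact isClosed_iInter fun s => isClosed_le (continuous_finsetSum _ fun k _ =>
        continuous_const.mul ((continuous_apply k).norm.pow 2)) continuous_const
    exact h1.inter h2
  · rw [mem_closedBall_zero_iff]
    refine (abs_le_of_sq_le_sq' ((norm_sq_le_of_mem_coeffBall ha k).trans ?_) hR).2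
    rw [mul_one_div, one_pow, one_mul]
    exact div_le_self (sq_nonneg R) (by linarith [sq_nonneg (freq P k)])

/-- The compact embedding of $H^1_P$ in $L^2_P$ in sequence form: on the ball $|a_k|^2\le
R^2/(1+\xi_k^2)$ is a summable majorant, so coordinatewise convergence passes to the sum. -/
theorem continuousOn_tsum_norm_sq {P R M : ℝ} (hP : 0 < P) {c : ℤ → ℝ} (hc : ∀ k, |c k| ≤ M) :
    ContinuousOn (fun a : ℤ → ℂ => ∑' k, c k * ‖a k‖ ^ 2) (coeffBall P R) := by
  have hM : 0 ≤ M := (abs_nonneg _).trans (hc 0)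
  refine continuousOn_tsum (u := fun k => M * (R ^ 2 * (1 / (1 + 1 ^ 2 * freq P k ^ 2))))
    (fun k => (continuous_const.mul ((continuous_apply k).norm.pow 2)).continuousOn)
    (((summable_inv_freq hP one_pos).1.mul_left _).mul_left _) fun k a ha => ?_
  rw [norm_mul, norm_pow, norm_norm, Real.norm_eq_abs]
  exact mul_le_mul (hc k) (norm_sq_le_of_mem_coeffBall ha k) (sq_nonneg _) hM

theorem continuousOn_tsum_dist_sq {P R : ℝ} (hP : 0 < P) {b : ℤ → ℂ} (hb : b ∈ coeffBall P R) :
    ContinuousOn (fun a : ℤ → ℂ => ∑' k, ‖a k - b k‖ ^ 2) (coeffBall P R) := by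
  refine continuousOn_tsum (u := fun k => 4 * (R ^ 2 * (1 / (1 + 1 ^ 2 * freq P k ^ 2))))
    (fun k => (((continuous_apply k).sub continuous_const).norm.pow 2).continuousOn)
    (((summable_inv_freq hP one_pos).1.mul_left _).mul_left _) fun k a ha => ?_
  rw [norm_pow, norm_norm]
  have h1 := norm_sq_le_of_mem_coeffBall ha k
  have h2 := norm_sq_le_of_mem_coeffBall hb k
  have h3 := pow_le_pow_left₀ (norm_nonneg _) (norm_sub_le (a k) (b k)) 2
  have h4 := add_sq_le (a := ‖a k‖) (b := ‖b k‖)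
  linarith

theorem integral_abs_le_sqrt {P : ℝ} (hP : 0 < P) {f : ℝ → ℝ} (hf : MemL2P P f) :
    ∫ x, |f x| ∂(periodMeasure P) ≤ √(P * ∫ x, f x ^ 2 ∂(periodMeasure P)) := by
  refine Real.le_sqrt_of_sq_le ?_
  set I := ∫ x, |f x| ∂(periodMeasure P) with hI
  -- Cauchy–Schwarz as nonnegativity of the variance of $|f|$, whose mean is $I/P$.
  have h1 : 0 ≤ ∫ x, (f x ^ 2 - 2 * (I / P) * |f x| + (I / P) ^ 2) ∂(periodMeasure P) :=
    integral_nonneg fun x => by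
      have := sq_nonneg (|f x| - I / P)
      rw [← sq_abs (f x)]
      simp only [Pi.zero_apply]
      linarith
  have i1 := hf.integrable_sq
  have i2 := hf.integrable.abs.const_mul (2 * (I / P))
  have i12 : Integrable (fun x => f x ^ 2 - 2 * (I / P) * |f x|) (periodMeasure P) := i1.sub i2
  have hvol : (periodMeasure P).real univ = P := by
    simp [measureReal_def, hP.le]
  rw [integral_add i12 (integrable_const _), integral_sub i1 i2, integral_const_mul, ← hI,
    integral_const, hvol, smul_eq_mul] at h1
  have h2 : 0 ≤ P * (∫ x, f x ^ 2 ∂(periodMeasure P) - 2 * (I / P) * I + P * (I / P) ^ 2) := by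
    positivity
  have h3 : P * (∫ x, f x ^ 2 ∂(periodMeasure P) - 2 * (I / P) * I + P * (I / P) ^ 2) =
      P * ∫ x, f x ^ 2 ∂(periodMeasure P) - I ^ 2 := by
    rw [mul_add, mul_sub]; field_simp; ring
  linarith

theorem abs_integral_primitive_sub_le {P : ℝ} (hP : 0 < P) {n : ℝ → ℝ} {ε r : ℝ} (hε : 0 ≤ ε)
    (hr : 0 ≤ r) (hn : Continuous n) (h0 : n 0 = 0)
    (hlip : ∀ x y, |x| ≤ r → |y| ≤ r → |n x - n y| ≤ ε * |x - y|) {u v : ℝ → ℝ}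
    (hu : MemL2P P u) (hv : MemL2P P v) (hub : ∀ x, |u x| ≤ r) (hvb : ∀ x, |v x| ≤ r) :
    |∫ x, primitive n (u x) ∂(periodMeasure P) - ∫ x, primitive n (v x) ∂(periodMeasure P)| ≤
      ε * r * √(P * ∑' k, ‖fourierCoeffP P u k - fourierCoeffP P v k‖ ^ 2) := by
  have hw := hu.add (hv.const_smul (-1))
  have h1 := integral_abs_le_sqrt hP hw
  rw [← intervalIntegral_eq_period hP, ← intervalIntegral_eq_period hP,
    ← (hw.hasSum_sq hP).tsum_eq, intervalIntegral_eq_period hP] at h1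
  have h2 : ∀ k, fourierCoeffP P (u + (-1 : ℝ) • v) k =
      fourierCoeffP P u k - fourierCoeffP P v k := fun k => by
    rw [fourierCoeffP_add hP hu (hv.const_smul _), fourierCoeffP_const_smul]
    push_cast; ring
  simp only [h2] at h1
  rw [← integral_sub
    (integrable_primitive_comp hε hn h0 hlip hu (Eventually.of_forall hub))
    (integrable_primitive_comp hε hn h0 hlip hv (Eventually.of_forall hvb))]
  refine le_trans ?_ (mul_le_mul_of_nonneg_left h1 (mul_nonneg hε hr))
  rw [← integral_const_mul, ← Real.norm_eq_abs]
  refine norm_integral_le_of_norm_le (hw.integrable.abs.const_mul _) (Eventually.of_forall ?_)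
  intro x
  have := abs_primitive_sub_le hε hn h0 hlip (hvb x) (hub x)
  simpa [sub_eq_add_neg] using this

/-- The direct method on coefficient sequences: the momentum constraint is a closed condition in a
compact set, and the energy is continuous there because $L^2$ distance controls the nonlinear term.
-/
theorem exists_minimiser_closedBall {m n : ℝ → ℝ} {M P ε r R μ : ℝ} (hP : 1 ≤ P)
    (hm : ∀ ξ, |m ξ| ≤ M) (heven : ∀ ξ, m (-ξ) = m ξ) (hε : 0 ≤ ε) (hr : 0 ≤ r) (hR : 0 ≤ R)
    (hn : Continuous n) (h0 : n 0 = 0)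
    (hlip : ∀ x y, |x| ≤ r → |y| ≤ r → |n x - n y| ≤ ε * |x - y|)
    (hsmall : ∀ a ∈ coeffBall P R, ∑' k, ‖a k‖ ^ 2 = 2 * μ → 1 / √P * ∑' k, ‖a k‖ ≤ r)
    (hne : ∃ w, MemHP P 1 w ∧ normHP P 1 w ≤ R ∧ momentum P w = μ) :
    ∃ a, (∀ k, a (-k) = (starRingEnd ℂ) (a k)) ∧
      Summable (fun k => (1 + freq P k ^ 2) * ‖a k‖ ^ 2) ∧
      normHP P 1 (synth P a) ≤ R ∧ momentum P (synth P a) = μ ∧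
      ∀ w, MemHP P 1 w → normHP P 1 w ≤ R → momentum P w = μ →
        energy m n P (synth P a) ≤ energy m n P w := by
  have hP0 : 0 < P := by linarith
  -- The factor 1 casts the momentum as a weighted sum covered by `continuousOn_tsum_norm_sq`.
  set S : Set (ℤ → ℂ) := coeffBall P R ∩ (fun a => ∑' k, (1 : ℝ) * ‖a k‖ ^ 2) ⁻¹' {2 * μ} with hS
  have hSsum : ∀ a ∈ S, ∑' k, ‖a k‖ ^ 2 = 2 * μ := fun a ha => by simpa using ha.2
  have hScl : IsCompact S := by
    have hcont := continuousOn_tsum_norm_sq (R := R) (M := 1) hP0 (c := fun _ => 1) (by simp)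
    exact (isCompact_coeffBall hR).of_isClosed_subset
      (hcont.preimage_isClosed_of_isClosed (isCompact_coeffBall hR).isClosed isClosed_singleton)
      inter_subset_left
  have hmem : ∀ w, MemHP P 1 w → normHP P 1 w ≤ R → momentum P w = μ →
      fourierCoeffP P w ∈ S := fun w hw hwR hwμ => by
    refine ⟨coeff_mem_coeffBall hw hwR, ?_⟩
    rw [momentum_eq hP0 hw.1] at hwμ
    simp only [mem_preimage, one_mul, mem_singleton_iff]
    linarith
  have hsummable : ∀ a ∈ S, Summable fun k => ‖a k‖ := fun a ha =>
    summable_norm_of_weighted hP (weighted_of_mem_coeffBall ha.1).1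
  have hbound : ∀ a ∈ S, ∀ x, |synth P a x| ≤ r := fun a ha x =>
    (abs_synth_le (hsummable a ha) x).trans (hsmall a ha.1 (hSsum a ha))
  have hcoeff : ∀ a ∈ S, ∀ k, fourierCoeffP P (synth P a) k = a k := fun a ha =>
    fourierCoeffP_synth hP0 (hsummable a ha) ha.1.1
  have hH : ∀ a ∈ S, MemHP P 1 (synth P a) := fun a ha =>
    memHP_synth hP (weighted_of_mem_coeffBall ha.1).1 ha.1.1
  set J : (ℤ → ℂ) → ℝ := fun a => -(1 / 2 * ∑' k, m (freq P k) * ‖a k‖ ^ 2) -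
    ∫ x, primitive n (synth P a x) ∂(periodMeasure P) with hJ
  have hJenergy : ∀ w, MemHP P 1 w → energy m n P w = J (fourierCoeffP P w) := by
    intro w hw
    rw [energy_eq hP hm heven hw, hJ]
    simp only
    congr 1
    refine integral_congr_ae ?_
    filter_upwards [hw.ae_eq_synth hP] with x hx
    rw [hx]
  have hJcont : ContinuousOn J S := by
    have h1 : ContinuousOn (fun a : ℤ → ℂ => ∑' k, m (freq P k) * ‖a k‖ ^ 2) S :=
      (continuousOn_tsum_norm_sq hP0 fun k => hm (freq P k)).mono inter_subset_left
    refine ((continuousOn_const.mul h1).neg).sub fun b hb => ?_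
    have h2 : ContinuousWithinAt
        (fun a : ℤ → ℂ => ε * r * √(P * ∑' k, ‖a k - b k‖ ^ 2)) S b :=
      continuousWithinAt_const.mul (continuousWithinAt_const.mul
        (((continuousOn_tsum_dist_sq hP0 hb.1).mono inter_subset_left) b hb)).sqrt
    unfold ContinuousWithinAt at h2
    simp only [sub_self, norm_zero, ne_eq, OfNat.ofNat_ne_zero, not_false_eq_true, zero_pow,
      tsum_zero, mul_zero, Real.sqrt_zero] at h2
    unfold ContinuousWithinAt
    rw [tendsto_iff_norm_sub_tendsto_zero]
    refine squeeze_zero' (Eventually.of_forall fun _ => norm_nonneg _) ?_ h2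
    filter_upwards [self_mem_nhdsWithin] with a ha
    have h3 := abs_integral_primitive_sub_le hP0 hε hr hn h0 hlip (hH a ha).1 (hH b hb).1
      (hbound a ha) (hbound b hb)
    rw [Real.norm_eq_abs]
    simpa only [hcoeff a ha, hcoeff b hb] using h3
  obtain ⟨w₀, hw₀, hw₀R, hw₀μ⟩ := hne
  obtain ⟨a, ha, hmin⟩ := hScl.exists_isMinOn ⟨_, hmem w₀ hw₀ hw₀R hw₀μ⟩ hJcont
  have hc : fourierCoeffP P (synth P a) = a := funext (hcoeff a ha)
  have hw := weighted_of_mem_coeffBall ha.1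
  refine ⟨a, ha.1.1, hw.1, ?_, ?_, fun w hw hwR hwμ => ?_⟩
  · refine (abs_le_of_sq_le_sq' ?_ hR).2
    rw [normHP_sq, hc]
    exact hw.2
  · rw [momentum_eq hP0 (hH a ha).1, hc, hSsum a ha]
    ring
  · rw [hJenergy _ (hH a ha), hc, hJenergy w hw]
    exact hmin (hmem w hw hwR hwμ)

/-! ### A priori bound for minimisers -/

theorem re_mul_conj_ofReal_mul (t : ℝ) (z : ℂ) :
    (z * (starRingEnd ℂ) (t * z)).re = t * ‖z‖ ^ 2 := by
  rw [map_mul, Complex.conj_ofReal, mul_left_comm, Complex.mul_conj, Complex.re_ofReal_mul,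
    Complex.ofReal_re, Complex.normSq_eq_norm_sq]

/-- Small nonlinearities act as small operators on `L²` and on the derivatives. -/
theorem comp_bounds {n : ℝ → ℝ} {P ε r : ℝ} (hP : 1 ≤ P) (hn : Continuous n)
    (h0 : n 0 = 0) (hlip : ∀ x y, |x| ≤ r → |y| ≤ r → |n x - n y| ≤ ε * |x - y|) {u : ℝ → ℝ}
    (hu : MemHP P 1 u) (huc : Continuous u) (hub : ∀ x, |u x| ≤ r) :
    MemHP P 1 (fun x => n (u x)) ∧
      ∑' k, ‖fourierCoeffP P (fun x => n (u x)) k‖ ^ 2 ≤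
        ε ^ 2 * ∑' k, ‖fourierCoeffP P u k‖ ^ 2 ∧
      ∑' k, freq P k ^ 2 * ‖fourierCoeffP P (fun x => n (u x)) k‖ ^ 2 ≤
        ε ^ 2 * ∑' k, freq P k ^ 2 * ‖fourierCoeffP P u k‖ ^ 2 := by
  have hP0 : 0 < P := by linarith
  have hg := memL2P_comp hn huc hu.1.1
  obtain ⟨h1, h2⟩ := tsum_freq_sq_le_of_increments (ε := ε) hP0 huc (hn.comp huc) hu.1.1 hg.1
    (fun x y => hlip _ _ (hub x) (hub y)) (summable_freq_sq_of_weighted hu.weighted)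
  refine ⟨memHP_one_iff.2 ⟨hg, ?_⟩, ?_, h2⟩
  · refine ((hg.hasSum_sq hP0).summable.add h1).congr fun k => ?_
    simp only [Function.comp_def]
    ring
  · rw [(hg.hasSum_sq hP0).tsum_eq, (hu.1.hasSum_sq hP0).tsum_eq]
    simp only [intervalIntegral_eq_period hP0]
    rw [← integral_const_mul]
    refine integral_mono hg.integrable_sq (hu.1.integrable_sq.const_mul _) fun x => ?_
    have h3 := pow_le_pow_left₀ (abs_nonneg _) (abs_le_of_lipschitz h0 hlip (hub x)) 2
    rw [mul_pow, sq_abs, sq_abs] at h3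
    exact h3

/-- The high-frequency multiplier `ξ²`, cut off at `X`. -/
noncomputable def highCut (X ξ : ℝ) : ℝ := if 2 ≤ |ξ| ∧ |ξ| ≤ X then ξ ^ 2 else 0

/-- The low-frequency cut-off. -/
noncomputable def lowCut (ξ : ℝ) : ℝ := if |ξ| < 1 then 1 else 0

theorem highCut_nonneg (X ξ : ℝ) : 0 ≤ highCut X ξ := by
  unfold highCut; split_ifs <;> positivity

theorem highCut_le (X ξ : ℝ) : highCut X ξ ≤ X ^ 2 := by
  unfold highCut; split_ifs with h
  · rw [← sq_abs ξ]
    have := h.2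
    gcongr
  · positivity

theorem lowCut_nonneg (ξ : ℝ) : 0 ≤ lowCut ξ := by
  unfold lowCut; split_ifs <;> norm_num

theorem lowCut_le (ξ : ℝ) : lowCut ξ ≤ 1 := by
  unfold lowCut; split_ifs <;> norm_num

theorem highCut_neg (X ξ : ℝ) : highCut X (-ξ) = highCut X ξ := by simp [highCut]

theorem lowCut_neg (ξ : ℝ) : lowCut (-ξ) = lowCut ξ := by simp [lowCut]

/-- The Sobolev weight is at most 2 where mass is added and at least 5 where it is removed. This gap
makes an $L^2$-neutral transfer strictly decrease the $H^1$ norm. -/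
theorem sobolev_weight_test_le {α : ℝ} (hα : 0 ≤ α) (X ξ : ℝ) :
    (1 + ξ ^ 2) * (α * lowCut ξ - highCut X ξ) ≤ 2 * α * lowCut ξ - 5 * highCut X ξ := by
  unfold lowCut highCut
  split_ifs with h1 h2 h2
  · linarith [h2.1]
  · have : ξ ^ 2 < 1 := by rw [← sq_abs]; nlinarith [abs_nonneg ξ]
    nlinarith
  · have : 4 ≤ ξ ^ 2 := by rw [← sq_abs]; nlinarith [abs_nonneg ξ, h2.1]
    nlinarith
  · simp

theorem symbol_test_le {m : ℝ → ℝ} {d α : ℝ} (hmax : ∀ ξ, m ξ ≤ m 0)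
    (hgap : ∀ ξ, 1 ≤ |ξ| → m ξ ≤ m 0 - d) (hα : 0 ≤ α) (X ξ : ℝ) :
    (m 0 - m ξ) * (α * lowCut ξ - highCut X ξ) ≤ α * (m 0 - m ξ) - d * highCut X ξ := by
  have h0 := hmax ξ
  have h1 : (m 0 - m ξ) * (α * lowCut ξ) ≤ α * (m 0 - m ξ) := by
    have := lowCut_le ξ
    have := mul_le_mul_of_nonneg_left this (mul_nonneg hα (sub_nonneg.2 h0))
    linarith
  have h2 : d * highCut X ξ ≤ (m 0 - m ξ) * highCut X ξ := by
    unfold highCut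
    split_ifs with h
    · have := hgap ξ (by linarith [h.1])
      gcongr
      linarith
    · simp
  linarith

/-- Young's inequality with different weights: $\varepsilon$ at low frequency, and $d$ at high
frequency so that a quarter of the linear gain absorbs the $y$ term. There the weight is at most
$\xi^2$, so the $z$ term is controlled by the derivative of $n(u)$. -/
theorem nonlinear_test_le {ε d α X ξ y z t : ℝ} (hε : 0 < ε) (hd : 0 < d) (hα : 0 ≤ α)
    (ht : |t| ≤ y * z) :
    -((α * lowCut ξ - highCut X ξ) * t) ≤
      α / 2 * (ε * y ^ 2 + ε⁻¹ * z ^ 2) +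
        (d / 4 * (highCut X ξ * y ^ 2) + d⁻¹ * (ξ ^ 2 * z ^ 2)) := by
  have hσ := highCut_nonneg X ξ
  have hl0 := lowCut_nonneg ξ
  have hl1 := lowCut_le ξ
  have hyz : 0 ≤ y * z := (abs_nonneg t).trans ht
  have h1 : y * z ≤ 1 / 2 * (ε * y ^ 2 + ε⁻¹ * z ^ 2) := by
    have h := sq_nonneg (ε * y - z)
    have : 0 ≤ ε⁻¹ * (ε * y - z) ^ 2 := by positivity
    have e : ε⁻¹ * (ε * y - z) ^ 2 = ε * y ^ 2 + ε⁻¹ * z ^ 2 - 2 * (y * z) := by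
      field_simp; ring
    linarith
  have h2 : y * z ≤ d / 4 * y ^ 2 + d⁻¹ * z ^ 2 := by
    have : 0 ≤ d⁻¹ * (d / 2 * y - z) ^ 2 := by positivity
    have e : d⁻¹ * (d / 2 * y - z) ^ 2 = d / 4 * y ^ 2 + d⁻¹ * z ^ 2 - y * z := by
      field_simp; ring
    linarith
  have h3 : highCut X ξ ≤ ξ ^ 2 := by
    unfold highCut; split_ifs
    · exact le_rfl
    · positivity
  have h4 : -(α * lowCut ξ * t) ≤ α / 2 * (ε * y ^ 2 + ε⁻¹ * z ^ 2) := by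
    have h5 : α * lowCut ξ * (-t) ≤ α * lowCut ξ * (y * z) := by
      gcongr; exact (neg_le_abs t).trans ht
    have h6 : α * lowCut ξ * (y * z) ≤ α * 1 * (y * z) := by gcongr
    have h7 : α * (y * z) ≤ α * (1 / 2 * (ε * y ^ 2 + ε⁻¹ * z ^ 2)) := by gcongr
    linarith
  have h8 : highCut X ξ * t ≤ d / 4 * (highCut X ξ * y ^ 2) + d⁻¹ * (ξ ^ 2 * z ^ 2) := by
    have h5 : highCut X ξ * t ≤ highCut X ξ * (y * z) := by
      gcongr; exact (le_abs_self t).trans ht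
    have h6 : highCut X ξ * (y * z) ≤ highCut X ξ * (d / 4 * y ^ 2 + d⁻¹ * z ^ 2) := by gcongr
    have h7 : d⁻¹ * (highCut X ξ * z ^ 2) ≤ d⁻¹ * (ξ ^ 2 * z ^ 2) := by gcongr
    linarith
  linarith

/-- Half the deficit is the energy excess over $-m(0)\mu$ plus $\int N(u)$; the first is at most
$2\varepsilon\mu$ by hypothesis, the second at most $\varepsilon\int u^2=2\varepsilon\mu$. -/
theorem tsum_symbol_deficit {m n : ℝ → ℝ} {M P ε r μ : ℝ} (hP : 1 ≤ P) (hm : ∀ ξ, |m ξ| ≤ M)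
    (heven : ∀ ξ, m (-ξ) = m ξ) (hε : 0 ≤ ε) (hn : Continuous n) (h0 : n 0 = 0)
    (hlip : ∀ x y, |x| ≤ r → |y| ≤ r → |n x - n y| ≤ ε * |x - y|) {u : ℝ → ℝ}
    (hu : MemHP P 1 u) (hub : ∀ x, |u x| ≤ r) (huμ : momentum P u = μ)
    (hen : energy m n P u ≤ -m 0 * μ + 2 * ε * μ) :
    Summable (fun k => (m 0 - m (freq P k)) * ‖fourierCoeffP P u k‖ ^ 2) ∧
    ∑' k, (m 0 - m (freq P k)) * ‖fourierCoeffP P u k‖ ^ 2 ≤ 8 * ε * μ := by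
  have hP0 : 0 < P := by linarith
  have hs0 := (hu.1.hasSum_sq hP0).summable
  have hs1 := (hasSum_opL_self hP hm heven hu).summable
  have e : ∀ k, (m 0 - m (freq P k)) * ‖fourierCoeffP P u k‖ ^ 2 =
      m 0 * ‖fourierCoeffP P u k‖ ^ 2 - m (freq P k) * ‖fourierCoeffP P u k‖ ^ 2 :=
    fun k => sub_mul _ _ _
  simp only [e]
  refine ⟨(hs0.mul_left _).sub hs1, ?_⟩
  rw [(hs0.mul_left _).tsum_sub hs1, tsum_mul_left]
  have h1 := abs_integral_primitive_le hε hn h0 hlip hu.1 (Eventually.of_forall hub)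
  rw [← intervalIntegral_eq_period hP0 (fun x => u x ^ 2), ← (hu.1.hasSum_sq hP0).tsum_eq] at h1
  rw [momentum_eq hP0 hu.1] at huμ
  rw [energy_eq hP hm heven hu] at hen
  have h2 := (abs_le.1 h1).2
  have h3 : ∑' k, ‖fourierCoeffP P u k‖ ^ 2 = 2 * μ := by linarith
  rw [h3] at h2 ⊢
  linarith

/-- A minimiser on a closed ball whose energy is close to that of the linear problem has
Sobolev norm of the order of its momentum, irrespective of the radius of the ball. -/
theorem minimiser_normHP_sq_le {m n : ℝ → ℝ} {M P ε r R μ d : ℝ} (hP : 1 ≤ P)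
    (hm : ∀ ξ, |m ξ| ≤ M) (heven : ∀ ξ, m (-ξ) = m ξ) (hmax : ∀ ξ, m ξ ≤ m 0) (hd : 0 < d)
    (hgap : ∀ ξ, 1 ≤ |ξ| → m ξ ≤ m 0 - d) (hε : 0 < ε) (hεd : 20 * ε ≤ d) (hr : 0 < r)
    (hμ : 0 < μ) (hn : Continuous n) (h0 : n 0 = 0)
    (hlip : ∀ x y, |x| ≤ r → |y| ≤ r → |n x - n y| ≤ ε * |x - y|) {u : ℝ → ℝ}
    (hu : MemHP P 1 u) (huc : Continuous u) (hub : ∀ x, |u x| ≤ r / 2)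
    (huR : normHP P 1 u ≤ R) (huμ : momentum P u = μ)
    (hmin : ∀ w, MemHP P 1 w → normHP P 1 w ≤ R → momentum P w = μ →
      energy m n P u ≤ energy m n P w)
    (hen : energy m n P u ≤ -m 0 * μ + 2 * ε * μ) :
    normHP P 1 u ^ 2 ≤ 11 * μ := by
  have hP0 : 0 < P := by linarith
  have hub' : ∀ x, |u x| ≤ r := fun x => by have := hub x; linarith
  obtain ⟨hdefs, hdef⟩ := tsum_symbol_deficit hP hm heven hε.le hn h0 hlip hu hub' huμ hen
  obtain ⟨hgH, hg0, hg1⟩ := comp_bounds hP hn h0 hlip hu huc hub'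
  set g : ℝ → ℝ := fun x => n (u x) with hg
  set T := ∑' k, freq P k ^ 2 * ‖fourierCoeffP P u k‖ ^ 2 with hT
  have hsT := summable_freq_sq_of_weighted hu.weighted
  have hs0 := (hu.1.hasSum_sq hP0).summable
  have hq : ∑' k, ‖fourierCoeffP P u k‖ ^ 2 = 2 * μ := by
    rw [momentum_eq hP0 hu.1] at huμ; linarith
  have hlow_s : Summable fun k => lowCut (freq P k) * ‖fourierCoeffP P u k‖ ^ 2 :=
    hs0.of_nonneg_of_le (fun k => mul_nonneg (lowCut_nonneg _) (sq_nonneg _))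
      fun k => mul_le_of_le_one_left (sq_nonneg _) (lowCut_le _)
  set B := ∑' k, lowCut (freq P k) * ‖fourierCoeffP P u k‖ ^ 2 with hB
  -- Momentum at $|\xi|\ge1$ costs at least $d$ per unit, while the total deficit is at most
  -- $8\varepsilon\mu\le d\mu$; so at least half of $\int u^2=2\mu$ lies at low frequency.
  have hBμ : μ ≤ B := by
    have h1 : ∑' k, d * (‖fourierCoeffP P u k‖ ^ 2 -
        lowCut (freq P k) * ‖fourierCoeffP P u k‖ ^ 2) ≤ 8 * ε * μ := by
      refine le_trans (Summable.tsum_le_tsum (fun k => ?_) ((hs0.sub hlow_s).mul_left d) hdefs) hdef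
      rw [← one_sub_mul, ← mul_assoc]
      gcongr
      unfold lowCut
      split_ifs with h
      · simpa using hmax (freq P k)
      · linarith [hgap _ (not_lt.1 h)]
    rw [tsum_mul_left, hs0.tsum_sub hlow_s, hq, ← hB] at h1
    have h2 : d * (2 * μ - B) ≤ d * μ := by
      refine h1.trans ?_
      gcongr
      linarith
    have := le_of_mul_le_mul_left h2 hd
    linarith
  have hB0 : 0 < B := hμ.trans_le hBμ
  have hhigh_s : ∀ X, Summable fun k => highCut X (freq P k) * ‖fourierCoeffP P u k‖ ^ 2 :=
    fun X => (hs0.mul_left (X ^ 2)).of_nonneg_of_le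
      (fun k => mul_nonneg (highCut_nonneg _ _) (sq_nonneg _))
      fun k => mul_le_mul_of_nonneg_right (highCut_le _ _) (sq_nonneg _)
  -- The cut-off at $X$ keeps the multiplier bounded, so the test function lies in $H^1_P$; the
  -- resulting estimate does not depend on $X$.
  have key : ∀ X, ∑' k, highCut X (freq P k) * ‖fourierCoeffP P u k‖ ^ 2 ≤ T / 100 := by
    intro X
    set S := ∑' k, highCut X (freq P k) * ‖fourierCoeffP P u k‖ ^ 2 with hS
    have hS0 : 0 ≤ S := tsum_nonneg fun k => mul_nonneg (highCut_nonneg _ _) (sq_nonneg _)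
    have hT0 : 0 ≤ T := tsum_nonneg fun k => by positivity
    rcases hS0.eq_or_lt with hS0 | hS0
    · rw [← hS0]; positivity
    -- This ratio makes the low-frequency gain cancel the high-frequency loss in $L^2$, so the
    -- variation is tangent to the momentum constraint.
    set α := S / B with hα
    have hα0 : 0 ≤ α := by positivity
    have hαB : α * B = S := by rw [hα]; field_simp
    have hαμ : α * μ ≤ S := by rw [← hαB]; gcongr
    set θ : ℝ → ℝ := fun ξ => α * lowCut ξ - highCut X ξ with hθ
    have hθb : ∀ ξ, |θ ξ| ≤ α + X ^ 2 := fun ξ => by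
      have h1 := lowCut_nonneg ξ
      have h2 := mul_le_mul_of_nonneg_left (lowCut_le ξ) hα0
      have h3 := highCut_nonneg X ξ
      have h4 := highCut_le X ξ
      have h5 := mul_nonneg hα0 h1
      rw [abs_le]
      constructor <;> simp only [hθ] <;> linarith [sq_nonneg X]
    have hθe : ∀ ξ, θ (-ξ) = θ ξ := fun ξ => by simp only [hθ, lowCut_neg, highCut_neg]
    obtain ⟨hvH, -, hvc⟩ := memHP_opL hP hθb hθe hu
    have hθsum : HasSum (fun k => θ (freq P k) * ‖fourierCoeffP P u k‖ ^ 2) 0 := by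
      have := (hlow_s.hasSum.mul_left α).sub (hhigh_s X).hasSum
      rw [← hB, ← hS, hαB, sub_self] at this
      exact hasSum_of_eq this (fun k => by simp only [hθ]; ring) rfl
    have horth : ∫ x in (-(P / 2))..(P / 2), u x * opL θ P u x = 0 :=
      (hasSum_opL_self hP hθb hθe hu).unique hθsum
    have hdir : innerHP P u (opL θ P u) < 0 := by
      have h1 : innerHP P u (opL θ P u) ≤
          ∑' k, (2 * α * (lowCut (freq P k) * ‖fourierCoeffP P u k‖ ^ 2) -
            5 * (highCut X (freq P k) * ‖fourierCoeffP P u k‖ ^ 2)) := by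
        refine Summable.tsum_le_tsum (fun k => ?_) (hu.summable_inner hvH)
          ((hlow_s.mul_left _).sub ((hhigh_s X).mul_left _))
        rw [hvc, re_mul_conj_ofReal_mul, ← mul_assoc]
        have := mul_le_mul_of_nonneg_right (sobolev_weight_test_le hα0 X (freq P k))
          (sq_nonneg ‖fourierCoeffP P u k‖)
        simp only [hθ]
        linarith
      rw [(hlow_s.mul_left _).tsum_sub ((hhigh_s X).mul_left _), tsum_mul_left, tsum_mul_left,
        ← hB, ← hS] at h1
      nlinarith
    have hvar := variational_inequality hP0 hμ (show 0 < r / 4 by linarith)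
      (memL2P_energyGrad hP hm heven hn hu huc).1 hu huR huμ hmin
      (fun w hw hwr => energy_expansion hP hm heven hε.le hn h0 hlip hu huc hub hw hwr)
      hvH horth (Or.inr hdir)
    rw [integral_energyGrad_mul hP hm heven hn hu huc hvH.1] at hvar
    have hlin : -∑' k, m (freq P k) * (fourierCoeffP P u k *
        (starRingEnd ℂ) (fourierCoeffP P (opL θ P u) k)).re ≤ 8 * ε * S - d * S := by
      have hs := (hasSum_mul_opL hP hm heven hu hvH.1).summable
      -- Since $\sum\theta|\hat u_k|^2=0$, the term with $m(0)$ is free and replaces $-m$ by the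
      -- deficit $m(0)-m$.
      have h1 : ∑' k, (m 0 * (θ (freq P k) * ‖fourierCoeffP P u k‖ ^ 2) -
          m (freq P k) * (fourierCoeffP P u k *
            (starRingEnd ℂ) (fourierCoeffP P (opL θ P u) k)).re) ≤
          ∑' k, (α * ((m 0 - m (freq P k)) * ‖fourierCoeffP P u k‖ ^ 2) -
            d * (highCut X (freq P k) * ‖fourierCoeffP P u k‖ ^ 2)) := by
        refine Summable.tsum_le_tsum (fun k => ?_) ((hθsum.summable.mul_left _).sub hs)
          ((hdefs.mul_left _).sub ((hhigh_s X).mul_left _))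
        rw [hvc, re_mul_conj_ofReal_mul]
        have := mul_le_mul_of_nonneg_right (symbol_test_le hmax hgap hα0 X (freq P k))
          (sq_nonneg ‖fourierCoeffP P u k‖)
        simp only [hθ]
        linarith
      rw [(hθsum.summable.mul_left _).tsum_sub hs, tsum_mul_left, hθsum.tsum_eq,
        (hdefs.mul_left _).tsum_sub ((hhigh_s X).mul_left _), tsum_mul_left, tsum_mul_left,
        ← hS] at h1
      have h2 : α * ∑' k, (m 0 - m (freq P k)) * ‖fourierCoeffP P u k‖ ^ 2 ≤ 8 * ε * S :=
        calc _ ≤ α * (8 * ε * μ) := by gcongr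
          _ = 8 * ε * (α * μ) := by ring
          _ ≤ _ := by gcongr
      linarith
    have hnon : -∫ x, g x * opL θ P u x ∂(periodMeasure P) ≤
        2 * ε * S + (d / 4 * S + d⁻¹ * (ε ^ 2 * T)) := by
      have hs := hasSum_mul_opL hP hθb hθe hu hgH.1
      rw [intervalIntegral_eq_period hP0] at hs
      have hgs0 := (hgH.1.hasSum_sq hP0).summable
      have hgs1 := summable_freq_sq_of_weighted hgH.weighted
      have r1 := ((hs0.mul_left ε).add (hgs0.mul_left ε⁻¹)).mul_left (α / 2)
      have r2 := ((hhigh_s X).mul_left (d / 4)).add (hgs1.mul_left d⁻¹)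
      have h1 := Summable.tsum_le_tsum (fun k => nonlinear_test_le (X := X) (ξ := freq P k)
        (t := (fourierCoeffP P u k * (starRingEnd ℂ) (fourierCoeffP P g k)).re)
        (y := ‖fourierCoeffP P u k‖) (z := ‖fourierCoeffP P g k‖) hε hd hα0 (by
          refine (Complex.abs_re_le_norm _).trans_eq ?_
          rw [norm_mul, Complex.norm_conj])) hs.summable.neg (r1.add r2)
      rw [tsum_neg, hs.tsum_eq, r1.tsum_add r2, tsum_mul_left,
        (hs0.mul_left ε).tsum_add (hgs0.mul_left ε⁻¹),
        ((hhigh_s X).mul_left (d / 4)).tsum_add (hgs1.mul_left d⁻¹),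
        tsum_mul_left, tsum_mul_left, tsum_mul_left, tsum_mul_left, hq, ← hS] at h1
      simp only [mul_comm (opL θ P u _)] at h1
      refine h1.trans ?_
      rw [hq] at hg0
      have h2 : α / 2 * (ε * (2 * μ) + ε⁻¹ * ∑' k, ‖fourierCoeffP P g k‖ ^ 2) ≤ 2 * ε * S :=
        calc _ ≤ α / 2 * (ε * (2 * μ) + ε⁻¹ * (ε ^ 2 * (2 * μ))) := by gcongr
          _ = 2 * ε * (α * μ) := by field_simp; ring
          _ ≤ _ := by gcongr
      gcongr
    -- With $20\varepsilon\le d$ the coefficient of $S$ is at most $-d/4$ and the last term at most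
    -- $dT/400$, which gives $S\le T/100$.
    have hfin : 0 ≤ 10 * ε * S - 3 / 4 * d * S + d⁻¹ * (ε ^ 2 * T) := by linarith
    have h1 : 20 * ε * S ≤ d * S := by gcongr
    have h2 : d⁻¹ * (ε ^ 2 * T) ≤ d / 400 * T := by
      have h3 : ε ^ 2 ≤ d ^ 2 / 400 := by nlinarith
      calc _ ≤ d⁻¹ * (d ^ 2 / 400 * T) := by gcongr
        _ = _ := by field_simp
    have h4 : d * S ≤ d * (T / 100) := by linarith
    exact le_of_mul_le_mul_left h4 hd
  -- Frequencies below 2 contribute at most $4\cdot2\mu$. In a finite partial sum all others lie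
  -- below some $X$, so `key` covers them; $T$ is finite, and its hundredth is absorbed.
  have hTle : T ≤ 8 * μ + T / 100 := by
    refine hsT.tsum_le_of_sum_le fun s => ?_
    obtain ⟨X, hX⟩ : ∃ X, ∀ k ∈ s, |freq P k| ≤ X := by
      obtain ⟨X, hX⟩ := (s.image fun k => |freq P k|).bddAbove
      exact ⟨X, fun k hk => hX (by simpa using ⟨k, hk, rfl⟩)⟩
    have h1 : ∑ k ∈ s, freq P k ^ 2 * ‖fourierCoeffP P u k‖ ^ 2 ≤
        ∑ k ∈ s, (4 * ‖fourierCoeffP P u k‖ ^ 2 +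
          highCut X (freq P k) * ‖fourierCoeffP P u k‖ ^ 2) := by
      refine Finset.sum_le_sum fun k hk => ?_
      rw [← add_mul]
      gcongr
      unfold highCut
      split_ifs with h
      · linarith
      · have h2 : |freq P k| < 2 := by
          by_contra! h3
          exact h ⟨h3, hX k hk⟩
        rw [← sq_abs]
        nlinarith [abs_nonneg (freq P k)]
    refine h1.trans ?_
    rw [Finset.sum_add_distrib, ← Finset.mul_sum]
    have h2 := hs0.sum_le_tsum s fun k _ => sq_nonneg _
    have h3 := (hhigh_s X).sum_le_tsum s fun k _ => mul_nonneg (highCut_nonneg _ _) (sq_nonneg _)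
    have h4 := key X
    rw [hq] at h2
    linarith
  rw [normHP_sq, tsum_weighted hu.weighted, hq, ← hT]
  linarith

/-! ### The Euler–Lagrange equation -/

theorem integral_mul_add_smul {P : ℝ} (hP : 0 < P) {g v w : ℝ → ℝ} (hg : MemL2P P g)
    (hv : MemL2P P v) (hw : MemL2P P w) (s t : ℝ) :
    ∫ x in (-(P / 2))..(P / 2), g x * (s • v + t • w) x =
      s * (∫ x in (-(P / 2))..(P / 2), g x * v x) +
        t * ∫ x in (-(P / 2))..(P / 2), g x * w x := by
  simp only [intervalIntegral_eq_period hP]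
  rw [← integral_const_mul, ← integral_const_mul,
    ← integral_add ((hg.integrable_mul hv).const_mul _) ((hg.integrable_mul hw).const_mul _)]
  congr 1; ext x; simp; ring

/-- Lagrange multiplier rule for a minimiser in the interior of a ball. -/
theorem euler_lagrange {P R μ K η : ℝ} (hP : 0 < P) (hμ : 0 < μ) (hη : 0 < η)
    {F : (ℝ → ℝ) → ℝ} {u g v : ℝ → ℝ} (hg : MemL2P P g) (hu : MemHP P 1 u)
    (huR : normHP P 1 u < R) (huμ : momentum P u = μ)
    (hmin : ∀ w, MemHP P 1 w → normHP P 1 w ≤ R → momentum P w = μ → F u ≤ F w)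
    (hF : ∀ w, MemHP P 1 w → normHP P 1 w ≤ η →
      |F (u + w) - F u - ∫ x in (-(P / 2))..(P / 2), g x * w x| ≤ K * normHP P 1 w ^ 2)
    (hv : MemHP P 1 v) :
    2 * μ * ∫ x in (-(P / 2))..(P / 2), g x * v x =
      (∫ x in (-(P / 2))..(P / 2), g x * u x) * ∫ x in (-(P / 2))..(P / 2), u x * v x := by
  set I := ∫ x in (-(P / 2))..(P / 2), u x * v x with hI
  have huu : ∫ x in (-(P / 2))..(P / 2), u x * u x = 2 * μ := by
    simp only [momentum, sq] at huμ
    linarith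
  -- The direction is $2\mu v-\langle u,v\rangle u$, orthogonal to $u$. In the interior both signs
  -- of $\sigma$ are admissible, which turns the inequality into an equality.
  have hvar : ∀ σ : ℝ, 0 ≤ σ * 2 * μ * (∫ x in (-(P / 2))..(P / 2), g x * v x) +
      -σ * I * ∫ x in (-(P / 2))..(P / 2), g x * u x := by
    intro σ
    have hw : MemHP P 1 ((σ * 2 * μ) • v + (-σ * I) • u) :=
      (hv.const_smul _).add hP (hu.const_smul _)
    have := variational_inequality hP hμ hη hg hu huR.le huμ hmin hF hw (by
      rw [integral_mul_add_smul hP hu.1 hv.1 hu.1, huu, ← hI]; ring) (Or.inl huR)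
    rwa [integral_mul_add_smul hP hg hv.1 hu.1] at this
  have h1 := hvar 1
  have h2 := hvar (-1)
  linarith

theorem eq_zero_of_integral_sq_eq_zero {P : ℝ} (hP : 0 < P) {g : ℝ → ℝ} (hg : MemL2P P g)
    (hgc : Continuous g) (h : ∫ x in (-(P / 2))..(P / 2), g x * g x = 0) : g = 0 := by
  have h0 : MemL2P P 0 := memL2P_of_continuous continuous_zero fun x => rfl
  refine eq_of_fourierCoeffP_eq hP hg h0 hgc continuous_zero fun k => ?_
  have h1 := hg.hasSum_sq hP
  simp only [sq (g _), h] at h1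
  have h2 := (hasSum_zero_iff_of_nonneg fun k => sq_nonneg _).1 h1
  have h3 := congrFun h2 k
  simp only [Pi.zero_apply, ne_eq, OfNat.ofNat_ne_zero, not_false_eq_true, pow_eq_zero_iff,
    norm_eq_zero] at h3
  rw [h3]
  simp [fourierCoeffP]

/-- A minimiser in the interior of a ball satisfies the travelling-wave equation. -/
theorem exists_wave_speed {m n : ℝ → ℝ} {M P ε r R μ : ℝ} (hP : 1 ≤ P)
    (hm : ∀ ξ, |m ξ| ≤ M) (heven : ∀ ξ, m (-ξ) = m ξ) (hmax : ∀ ξ, m ξ ≤ m 0)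
    (hε : 0 < ε) (hr : 0 < r)
    (hμ : 0 < μ) (hn : Continuous n) (h0 : n 0 = 0)
    (hlip : ∀ x y, |x| ≤ r → |y| ≤ r → |n x - n y| ≤ ε * |x - y|) {u : ℝ → ℝ}
    (hu : MemHP P 1 u) (huc : Continuous u) (hub : ∀ x, |u x| ≤ r / 2)
    (huR : normHP P 1 u < R) (huμ : momentum P u = μ)
    (hmin : ∀ w, MemHP P 1 w → normHP P 1 w ≤ R → momentum P w = μ →
      energy m n P u ≤ energy m n P w)
    (hen : energy m n P u ≤ -m 0 * μ + 2 * ε * μ) :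
    ∃ ν : ℝ, (∀ x, energyGrad m n P u x + ν * u x = 0) ∧ m 0 - 5 * ε ≤ ν ∧ ν ≤ m 0 + ε := by
  have hP0 : 0 < P := by linarith
  have hub' : ∀ x, |u x| ≤ r := fun x => by have := hub x; linarith
  obtain ⟨hgL, hgc⟩ := memL2P_energyGrad hP hm heven hn hu huc
  obtain ⟨hnH, -, -⟩ := comp_bounds hP hn h0 hlip hu huc hub'
  obtain ⟨hdefs, hdef⟩ := tsum_symbol_deficit hP hm heven hε.le hn h0 hlip hu hub' huμ hen
  set g := energyGrad m n P u with hg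
  set G := ∫ x in (-(P / 2))..(P / 2), g x * u x with hG
  -- The gradient itself lies in $H^1_P$, so the residual of the Euler–Lagrange equation may be used
  -- as its own test function.
  have hgH : MemHP P 1 g := by
    have h1 := ((memHP_opL hP hm heven hu).1.const_smul (-1)).add hP0 (hnH.const_smul (-1))
    convert h1 using 1
    ext x
    simp [hg, energyGrad, sub_eq_add_neg]
  refine ⟨-G / (2 * μ), fun x => ?_, ?_⟩
  · have hEL : ∀ v, MemHP P 1 v → 2 * μ * (∫ x in (-(P / 2))..(P / 2), g x * v x) =
        G * ∫ x in (-(P / 2))..(P / 2), u x * v x := fun v hv =>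
      euler_lagrange hP0 hμ (show 0 < r / 4 by linarith) hgL hu huR huμ hmin
        (fun w hw hwr => energy_expansion hP hm heven hε.le hn h0 hlip hu huc hub hw hwr) hv
    set q : ℝ → ℝ := (1 : ℝ) • g + (-G / (2 * μ)) • u with hq
    have hqH : MemHP P 1 q := (hgH.const_smul _).add hP0 (hu.const_smul _)
    have hqc : Continuous q := (hgc.const_smul _).add (huc.const_smul _)
    have hzero : ∫ x in (-(P / 2))..(P / 2), q x * q x = 0 := by
      have h1 := integral_mul_add_smul hP0 hqH.1 hgL hu.1 1 (-G / (2 * μ))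
      rw [← hq] at h1
      simp only [mul_comm (q _) (g _), mul_comm (q _) (u _)] at h1
      have h2 := hEL q hqH
      rw [h1]
      field_simp
      linear_combination h2
    have h3 := congrFun (eq_zero_of_integral_sq_eq_zero hP0 hqH.1 hqc hzero) x
    simpa [hq] using h3
  · have hs0 := (hu.1.hasSum_sq hP0).summable
    have hs1 := (hasSum_opL_self hP hm heven hu).summable
    have hq : ∑' k, ‖fourierCoeffP P u k‖ ^ 2 = 2 * μ := by
      rw [momentum_eq hP0 hu.1] at huμ; linarith
    have hGe : G = -(∑' k, m (freq P k) * ‖fourierCoeffP P u k‖ ^ 2) -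
        ∫ x, n (u x) * u x ∂(periodMeasure P) := by
      rw [hG, integral_energyGrad_mul hP hm heven hn hu huc hu.1]
      simp only [Complex.mul_conj, Complex.ofReal_re, Complex.normSq_eq_norm_sq]
    have hnb : |∫ x, n (u x) * u x ∂(periodMeasure P)| ≤ ε * (2 * μ) := by
      rw [← hq, (hu.1.hasSum_sq hP0).tsum_eq, intervalIntegral_eq_period hP0,
        ← integral_const_mul, ← Real.norm_eq_abs]
      refine norm_integral_le_of_norm_le (hu.1.integrable_sq.const_mul ε)
        (Eventually.of_forall fun x => ?_)
      rw [Real.norm_eq_abs, abs_mul, ← sq_abs (u x), sq, ← mul_assoc]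
      exact mul_le_mul_of_nonneg_right (abs_le_of_lipschitz h0 hlip (hub' x)) (abs_nonneg _)
    have hle : ∑' k, m (freq P k) * ‖fourierCoeffP P u k‖ ^ 2 ≤ m 0 * (2 * μ) := by
      rw [← hq, ← tsum_mul_left]
      exact hs1.tsum_le_tsum (fun k => mul_le_mul_of_nonneg_right (hmax _) (sq_nonneg _))
        (hs0.mul_left _)
    have hge : m 0 * (2 * μ) - ∑' k, m (freq P k) * ‖fourierCoeffP P u k‖ ^ 2 ≤ 8 * ε * μ := by
      rw [← hq, ← tsum_mul_left, ← (hs0.mul_left _).tsum_sub hs1]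
      simpa only [sub_mul] using hdef
    rw [abs_le] at hnb
    constructor
    · rw [le_div_iff₀ (by positivity)]
      linarith
    · rw [div_le_iff₀ (by positivity)]
      linarith

/-! ### Consequences of the assumptions on the symbol and the nonlinearity -/

theorem AssumptionA1.bounded {m : ℝ → ℝ} {m₀ : ℝ} (h : AssumptionA1 m m₀) :
    ∃ M, ∀ ξ, |m ξ| ≤ M := by
  obtain ⟨C, hC⟩ := h.bound 0
  refine ⟨|C|, fun ξ => ?_⟩
  have h1 := hC ξ
  rw [iteratedDeriv_zero] at h1
  have h2 : (1 + |ξ|) ^ (m₀ - ((0 : ℕ) : ℝ)) ≤ 1 :=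
    Real.rpow_le_one_of_one_le_of_nonpos (by linarith [abs_nonneg ξ]) (by simpa using h.order_neg.le)
  have h3 : 0 ≤ (1 + |ξ|) ^ (m₀ - ((0 : ℕ) : ℝ)) := by positivity
  calc |m ξ| ≤ C * (1 + |ξ|) ^ (m₀ - ((0 : ℕ) : ℝ)) := h1
    _ ≤ |C| * (1 + |ξ|) ^ (m₀ - ((0 : ℕ) : ℝ)) := by gcongr; exact le_abs_self C
    _ ≤ |C| * 1 := by gcongr
    _ = |C| := mul_one _

theorem AssumptionA1.tendsto_zero {m : ℝ → ℝ} {m₀ : ℝ} (h : AssumptionA1 m m₀) :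
    Tendsto m atTop (𝓝 0) := by
  obtain ⟨C, hC⟩ := h.bound 0
  have h1 : Tendsto (fun ξ : ℝ => C * (1 + ξ) ^ (m₀ - ((0 : ℕ) : ℝ))) atTop (𝓝 (C * 0)) := by
    refine Tendsto.const_mul C ?_
    have h2 := (tendsto_rpow_neg_atTop (y := -m₀) (by linarith [h.order_neg])).comp
      (tendsto_atTop_add_const_left atTop (1 : ℝ) tendsto_id)
    simpa [Function.comp_def] using h2
  rw [mul_zero] at h1
  refine squeeze_zero_norm' ?_ h1
  filter_upwards [eventually_ge_atTop 0] with ξ hξ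
  have := hC ξ
  rwa [iteratedDeriv_zero, abs_of_nonneg hξ] at this

/-- Decay at infinity gives the gap $m(0)/2$ far out; on the remaining compact interval strictness
of the maximum at 0 gives a positive gap, and evenness covers negative frequencies. -/
theorem exists_symbol_gap {m : ℝ → ℝ} {m₀ : ℝ} {j : ℕ} (h1 : AssumptionA1 m m₀)
    (h2 : AssumptionA2 m j) : ∃ d, 0 < d ∧ ∀ ξ, 1 ≤ |ξ| → m ξ ≤ m 0 - d := by
  have hpos := h2.zero_pos
  have h3 : ∀ᶠ ξ in atTop, m ξ < m 0 / 2 :=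
    h1.tendsto_zero.eventually (eventually_lt_nhds (by linarith))
  obtain ⟨X, hX⟩ := eventually_atTop.1 h3
  have hX1 : (1 : ℝ) ∈ Icc 1 (max X 1) := ⟨le_rfl, le_max_right _ _⟩
  obtain ⟨y, hy, hymax⟩ := isCompact_Icc.exists_isMaxOn ⟨1, hX1⟩
    h1.smooth.continuous.continuousOn
  have hy0 : m y < m 0 := h2.lt_zero y (by linarith [hy.1])
  refine ⟨min (m 0 / 2) (m 0 - m y), lt_min (by linarith) (by linarith), fun ξ hξ => ?_⟩
  have habs : m |ξ| = m ξ := by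
    rcases abs_choice ξ with h | h
    · rw [h]
    · rw [h, h2.even]
  rw [← habs]
  rcases le_total |ξ| (max X 1) with h | h
  · have h5 : m |ξ| ≤ m y := hymax ⟨hξ, h⟩
    have := min_le_right (m 0 / 2) (m 0 - m y)
    linarith
  · have h5 := hX |ξ| ((le_max_left _ _).trans h)
    have := min_le_left (m 0 / 2) (m 0 - m y)
    linarith

theorem IsLeadingPart.isBigO_sq {cp p : ℝ} {np : ℝ → ℝ} (h : IsLeadingPart cp p np)
    (hp : 2 ≤ p) : np =O[𝓝 0] fun x : ℝ => x ^ 2 := by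
  have hpow : ∀ x : ℝ, |x| ≤ 1 → |x| ^ p ≤ x ^ 2 := by
    intro x hx
    rcases (abs_nonneg x).eq_or_lt with h0 | h0
    · rw [← h0, Real.zero_rpow (by linarith)]; positivity
    · rw [← sq_abs, ← Real.rpow_two]
      exact Real.rpow_le_rpow_of_exponent_ge h0 hx hp
  have habs : ∀ x, |np x| = |cp| * |x| ^ p := by
    rcases h with ⟨-, h⟩ | ⟨-, q, -, hq, h⟩
    · intro x
      rw [h, abs_mul, abs_of_nonneg (Real.rpow_nonneg (abs_nonneg x) p)]
    · intro x
      rw [h, abs_mul, abs_pow, hq, Real.rpow_natCast]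
  refine IsBigO.of_bound |cp| ?_
  filter_upwards [Metric.closedBall_mem_nhds (0 : ℝ) one_pos] with x hx
  rw [mem_closedBall_zero_iff, Real.norm_eq_abs] at hx
  rw [Real.norm_eq_abs, habs, Real.norm_of_nonneg (sq_nonneg x)]
  gcongr
  exact hpow x hx

theorem AssumptionA3.isBigO_sq {n np nr : ℝ → ℝ} {j : ℕ} {cp p δ : ℝ}
    (h : AssumptionA3 n j cp p δ np nr) : n =O[𝓝 0] fun x : ℝ => x ^ 2 := by
  rw [show n = fun x => np x + nr x from funext h.split]
  refine (h.leading.isBigO_sq h.two_le).add (h.higher.trans ?_)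
  refine IsBigO.of_bound 1 ?_
  filter_upwards [Metric.closedBall_mem_nhds (0 : ℝ) one_pos] with x hx
  rw [mem_closedBall_zero_iff, Real.norm_eq_abs] at hx
  rw [Real.norm_of_nonneg (Real.rpow_nonneg (abs_nonneg x) _), one_mul,
    Real.norm_of_nonneg (sq_nonneg x)]
  have hp : 2 ≤ p + δ := by linarith [h.two_le, h.δ_pos]
  rcases (abs_nonneg x).eq_or_lt with h0 | h0
  · rw [← h0, Real.zero_rpow (by linarith)]; positivity
  · rw [← sq_abs, ← Real.rpow_two]
    exact Real.rpow_le_rpow_of_exponent_ge h0 hx hp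

theorem AssumptionA3.zero {n np nr : ℝ → ℝ} {j : ℕ} {cp p δ : ℝ}
    (h : AssumptionA3 n j cp p δ np nr) : n 0 = 0 := by
  obtain ⟨C, hC⟩ := h.isBigO_sq.bound
  simpa using hC.self_of_nhds

/-- Near the origin the nonlinearity has an arbitrarily small Lipschitz constant. -/
theorem AssumptionA3.exists_lipschitz {n np nr : ℝ → ℝ} {j : ℕ} {cp p δ : ℝ}
    (h : AssumptionA3 n j cp p δ np nr) {ε : ℝ} (hε : 0 < ε) :
    ∃ r, 0 < r ∧ ∀ x y, |x| ≤ r → |y| ≤ r → |n x - n y| ≤ ε * |x - y| := by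
  have hd : HasDerivAt n 0 0 := by
    rw [hasDerivAt_iff_isLittleO_nhds_zero]
    have h1 : (fun x : ℝ => x ^ 2) =o[𝓝 0] fun x : ℝ => x := by
      simpa using isLittleO_pow_pow (𝕜 := ℝ) (m := 1) (n := 2) one_lt_two
    simpa [h.zero] using h.isBigO_sq.trans_isLittleO h1
  -- As $n$ is $C^2$ and $O(x^2)$ at 0, its derivative 0 there is strict, which is precisely an
  -- arbitrarily small local Lipschitz constant.
  have hsd : HasStrictDerivAt n 0 0 := by
    have h1 := (h.smooth.contDiffAt (x := (0 : ℝ))).hasStrictDerivAt (by norm_num)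
    rwa [hd.deriv] at h1
  obtain ⟨s, hs, hlip⟩ := hsd.hasStrictFDerivAt.approximates_deriv_on_nhds (c := ⟨ε, hε.le⟩)
    (Or.inr hε)
  obtain ⟨r, hr, hrs⟩ := Metric.nhds_basis_closedBall.mem_iff.1 hs
  refine ⟨r, hr, fun x y hx hy => ?_⟩
  have h2 := hlip x (hrs (by simpa using hx)) y (hrs (by simpa using hy))
  simp only [ContinuousLinearMap.toSpanSingleton_zero, zero_apply, sub_zero] at h2
  exact h2

/-- Interpolation with $\tau=\sqrt\mu$, which balances $L^2$ norm squared $2\mu$ against derivative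
norm squared at most $R^2$ and yields $3\sqrt\mu\,(2+R^2)$, uniformly in $P\ge1$. -/
theorem small_of_mem_coeffBall {P R μ r : ℝ} (hP : 1 ≤ P) (hr : 0 ≤ r) (hμ : 0 < μ)
    (hμ1 : μ ≤ 1) (hμr : 3 * √μ * (2 + R ^ 2) ≤ r ^ 2) {a : ℤ → ℂ} (ha : a ∈ coeffBall P R)
    (haμ : ∑' k, ‖a k‖ ^ 2 = 2 * μ) : 1 / √P * ∑' k, ‖a k‖ ≤ r := by
  obtain ⟨hw, hwR⟩ := weighted_of_mem_coeffBall ha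
  have hτ : 0 < √μ := Real.sqrt_pos.2 hμ
  have h1 := (sq_sum_norm_le hP hτ (Real.sqrt_le_one.2 hμ1) (summable_norm_sq_of_weighted hw)
    (summable_freq_sq_of_weighted hw)).2
  rw [tsum_weighted hw, haμ] at hwR
  refine (abs_le_of_sq_le_sq' (h1.trans (le_trans ?_ hμr)) hr).2
  rw [haμ, Real.sq_sqrt hμ.le]
  have h2 : ∑' k, freq P k ^ 2 * ‖a k‖ ^ 2 ≤ R ^ 2 := by linarith
  calc 3 / √μ * (2 * μ + μ * ∑' k, freq P k ^ 2 * ‖a k‖ ^ 2)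
      ≤ 3 / √μ * (2 * μ + μ * R ^ 2) := by gcongr
    _ = 3 * (μ / √μ) * (2 + R ^ 2) := by ring
    _ = 3 * √μ * (2 + R ^ 2) := by rw [Real.div_sqrt]

/-- The constant function with momentum `μ`. -/
theorem exists_constant_competitor {m n : ℝ → ℝ} {M P ε r μ : ℝ} (hP : 1 ≤ P)
    (hm : ∀ ξ, |m ξ| ≤ M) (heven : ∀ ξ, m (-ξ) = m ξ) (hε : 0 ≤ ε) (hμ : 0 ≤ μ)
    (hn : Continuous n) (h0 : n 0 = 0)
    (hlip : ∀ x y, |x| ≤ r → |y| ≤ r → |n x - n y| ≤ ε * |x - y|) (hr : √(2 * μ) ≤ r) :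
    ∃ w, MemHP P 1 w ∧ normHP P 1 w ^ 2 = 2 * μ ∧ momentum P w = μ ∧
      energy m n P w ≤ -m 0 * μ + 2 * ε * μ := by
  have hP0 : 0 < P := by linarith
  set a : ℤ → ℂ := Pi.single 0 ((√(2 * μ) : ℝ) : ℂ) with ha
  have hne : ∀ k, k ≠ 0 → a k = 0 := fun k hk => by simp [ha, hk]
  have ha0 : ‖a 0‖ = √(2 * μ) := by
    rw [ha, Pi.single_eq_same, Complex.norm_real, Real.norm_of_nonneg (Real.sqrt_nonneg _)]
  have hsum : ∀ c : ℤ → ℝ, HasSum (fun k => c k * ‖a k‖ ^ 2) (c 0 * (2 * μ)) := fun c => by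
    have := hasSum_single (f := fun k => c k * ‖a k‖ ^ 2) 0 fun k hk => by simp [hne k hk]
    rwa [ha0, Real.sq_sqrt (by positivity)] at this
  have hsym : ∀ k, a (-k) = (starRingEnd ℂ) (a k) := fun k => by
    rcases eq_or_ne k 0 with rfl | hk
    · simp [ha, Complex.conj_ofReal]
    · rw [hne k hk, hne (-k) (by simpa using hk), map_zero]
  have hw := hsum fun k => 1 + freq P k ^ 2
  have hs := summable_norm_of_weighted hP hw.summable
  have hH := memHP_synth hP hw.summable hsym
  have hc := fourierCoeffP_synth hP0 hs hsym
  have hl1 : ∑' k, ‖a k‖ = √(2 * μ) := by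
    rw [tsum_eq_single 0 fun k hk => by simp [hne k hk], ha0]
  have hmom : ∑' k, ‖fourierCoeffP P (synth P a) k‖ ^ 2 = 2 * μ := by
    simpa [hc] using (hsum fun _ => 1).tsum_eq
  have hb : ∀ x, |synth P a x| ≤ r := fun x => by
    refine (abs_synth_le hs x).trans (le_trans ?_ hr)
    rw [hl1]
    exact mul_le_of_le_one_left (Real.sqrt_nonneg _)
      (by rw [div_le_one (by positivity)]; exact Real.one_le_sqrt.2 hP)
  refine ⟨synth P a, hH, ?_, ?_, ?_⟩
  · rw [normHP_sq]
    simp only [hc]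
    rw [hw.tsum_eq]
    simp [freq]
  · rw [momentum_eq hP0 hH.1, hmom]; ring
  · have h1 := abs_integral_primitive_le hε hn h0 hlip hH.1 (Eventually.of_forall hb)
    rw [← intervalIntegral_eq_period hP0 (fun x => synth P a x ^ 2),
      ← (hH.1.hasSum_sq hP0).tsum_eq, hmom] at h1
    rw [energy_eq hP hm heven hH]
    simp only [hc]
    rw [(hsum fun k => m (freq P k)).tsum_eq]
    have h2 := (abs_le.1 h1).1
    simp only [freq, Int.cast_zero, mul_zero, zero_div]
    linarith

end Whitham

/-! ### Choice of constants and conclusion -/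

theorem theorem3p6
    (m n : ℝ → ℝ) (m₀ : ℝ) (j : ℕ) (cp p δ : ℝ) (np nr : ℝ → ℝ)
    (hA1 : Whitham.AssumptionA1 m m₀)
    (hA2 : Whitham.AssumptionA2 m j)
    (hA3 : Whitham.AssumptionA3 n j cp p δ np nr)
    (R : ℝ) (hR : 0 < R) :
    ∃ c : ℝ, 0 < c ∧ ∃ μs : ℝ, 0 < μs ∧ ∀ μ : ℝ, 0 < μ → μ < μs →
      ∃ Pμ : ℝ, 0 < Pμ ∧ ∀ P : ℝ, Pμ ≤ P →
        ∃ u ∈ Whitham.constraintSet R P μ, ∃ ν : ℝ,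
          Continuous u ∧
          IsMinOn (Whitham.energy m n P) (Whitham.constraintSet R P μ) u ∧
          Whitham.energy m n P u =
            sInf (Whitham.energy m n P '' Whitham.constraintSet R P μ) ∧
          (∃ gE gQ : ℝ → ℝ,
            Whitham.HasL2Derivative P (Whitham.energy m n P) u gE ∧
            Whitham.HasL2Derivative P (Whitham.momentum P) u gQ ∧
            ∀ x : ℝ, gE x + ν * gQ x = 0) ∧
          (∀ x : ℝ, Whitham.opL m P u x - ν * u x + n (u x) = 0) ∧
          Whitham.normHP P 1 u ^ 2 ≤ c * μ ∧
          0 < ν ∧ ν ≤ c := by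
  open Whitham in
  obtain ⟨M, hM⟩ := hA1.bounded
  obtain ⟨d, hd, hgap⟩ := exists_symbol_gap hA1 hA2
  have hmax : ∀ ξ, m ξ ≤ m 0 := fun ξ => by
    rcases eq_or_ne ξ 0 with rfl | hξ
    · exact le_rfl
    · exact (hA2.lt_zero ξ hξ).le
  have hm0 := hA2.zero_pos
  have hn : Continuous n := hA3.smooth.continuous
  have h0 := hA3.zero
  -- The first bound serves the a priori estimate; the second gives $\nu\ge m(0)-5\varepsilon\ge
  -- m(0)/2>0$.
  set ε := min (d / 20) (m 0 / 10) with hεdef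
  have hε : 0 < ε := lt_min (by positivity) (by positivity)
  have hε1 : 20 * ε ≤ d := by have := min_le_left (d / 20) (m 0 / 10); linarith
  have hε2 : 10 * ε ≤ m 0 := by have := min_le_right (d / 20) (m 0 / 10); linarith
  obtain ⟨r, hr, hlip⟩ := hA3.exists_lipschitz hε
  -- The constant dominates both $11$ and $m(0)+\varepsilon$. The bounds on $\mu$ ensure in turn
  -- $\tau=\sqrt\mu\le1$, $11\mu<R^2$ (interior minimiser), $\sqrt{2\mu}\le r$ (constant competitor)
  -- and $3\sqrt\mu(2+R^2)\le(r/2)^2$ (sup bound). All estimates are uniform in $P\ge1$, so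
  -- $P_\mu=1$ works.
  refine ⟨2 * m 0 + 11, by positivity,
    min (min 1 (R ^ 2 / 11)) (min (r ^ 2 / 2) ((r ^ 2 / (12 * (2 + R ^ 2))) ^ 2)),
    by positivity, fun μ hμ hμs => ⟨1, one_pos, fun P hP => ?_⟩⟩
  have hP0 : 0 < P := by linarith
  obtain ⟨⟨hμ1, hμR⟩, hμr, hμrR⟩ :
      (μ < 1 ∧ μ < R ^ 2 / 11) ∧ μ < r ^ 2 / 2 ∧ μ < (r ^ 2 / (12 * (2 + R ^ 2))) ^ 2 := by
    simpa only [lt_min_iff] using hμs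
  have hsmall : ∀ a ∈ coeffBall P R, ∑' k, ‖a k‖ ^ 2 = 2 * μ →
      1 / √P * ∑' k, ‖a k‖ ≤ r / 2 := fun a ha haμ => by
    refine small_of_mem_coeffBall hP (by positivity) hμ hμ1.le ?_ ha haμ
    have h1 : √μ ≤ r ^ 2 / (12 * (2 + R ^ 2)) := Real.sqrt_le_iff.2 ⟨by positivity, hμrR.le⟩
    rw [le_div_iff₀ (by positivity)] at h1
    linarith
  have hlip2 : ∀ x y, |x| ≤ r / 2 → |y| ≤ r / 2 → |n x - n y| ≤ ε * |x - y| := fun x y hx hy =>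
    hlip x y (by linarith) (by linarith)
  obtain ⟨w₀, hw₀, hw₀n, hw₀μ, hw₀E⟩ := exists_constant_competitor hP hM hA2.even hε.le hμ.le hn h0
    hlip (Real.sqrt_le_iff.2 ⟨hr.le, by linarith⟩)
  have hw₀R : normHP P 1 w₀ ≤ R := by
    refine (abs_le_of_sq_le_sq' ?_ hR.le).2
    rw [hw₀n]
    linarith
  obtain ⟨a, hsym, hw, huR, huμ, hmin⟩ := exists_minimiser_closedBall hP hM hA2.even hε.le
    (by positivity : 0 ≤ r / 2) hR.le hn h0 hlip2 hsmall ⟨w₀, hw₀, hw₀R, hw₀μ⟩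
  have hs := summable_norm_of_weighted hP hw
  have hu := memHP_synth hP hw hsym
  have huc := continuous_synth (P := P) hs
  have hcoeff := fourierCoeffP_synth hP0 hs hsym
  set u := synth P a with hudef
  have hub : ∀ x, |u x| ≤ r / 2 := fun x => by
    refine (abs_synth_le hs x).trans (hsmall a ?_ ?_)
    · rw [← funext hcoeff]
      exact coeff_mem_coeffBall hu huR
    · rw [momentum_eq hP0 hu.1] at huμ
      simp only [hcoeff] at huμ
      linarith
  have hen : energy m n P u ≤ -m 0 * μ + 2 * ε * μ := (hmin w₀ hw₀ hw₀R hw₀μ).trans hw₀E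
  have hbound := minimiser_normHP_sq_le hP hM hA2.even hmax hd hgap hε hε1 hr hμ hn h0 hlip hu huc
    hub huR huμ hmin hen
  have huR' : normHP P 1 u < R := by
    refine lt_of_pow_lt_pow_left₀ 2 hR.le ?_
    linarith
  obtain ⟨ν, hEL, hν1, hν2⟩ := exists_wave_speed hP hM hA2.even hmax hε hr hμ hn h0 hlip hu huc hub
    huR' huμ hmin hen
  have hmem : u ∈ constraintSet R P μ := ⟨hu, huR', huμ⟩
  have hminOn : IsMinOn (energy m n P) (constraintSet R P μ) u := fun w hw =>
    hmin w hw.1 hw.2.1.le hw.2.2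
  refine ⟨u, hmem, ν, huc, hminOn, ?_, ⟨energyGrad m n P u, u, ?_,
    hasL2Derivative_momentum hP0 hu.1, hEL⟩, fun x => ?_, ?_, ?_, ?_⟩
  · refine (IsLeast.csInf_eq ⟨mem_image_of_mem _ hmem, ?_⟩).symm
    rintro _ ⟨w, hw, rfl⟩
    exact hminOn hw
  · exact hasL2Derivative_of_quadratic (memL2P_energyGrad hP hM hA2.even hn hu huc).1
      (show 0 < r / 4 by positivity)
      fun v hv hvr => energy_expansion hP hM hA2.even hε.le hn h0 hlip hu huc hub hv hvr
  · have := hEL x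
    simp only [energyGrad] at this
    linarith
  · nlinarith
  · linarith
  · linarith
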